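/- Let $\mathbb{F}_q$ be a finite field, $n,k\ge 0$ integers, $G=\mathrm{GL}_n$ over $\overline{\mathbb{F}}_q$ with the standard Frobenius $F$ (raising all matrix entries to the power $q$). For $i=1,\dots,k$ let $L_i=\mathrm{GL}_{n_{i,0}}\times\cdots\times\mathrm{GL}_{n_{i,s_i}}\subseteq G$ be a block diagonal Levi subgroup, with $n_{i,l}\ge 0$ and $\sum_l n_{i,l}=n$ (the blocks of sizes $n_{i,s_i},\dots,n_{i,0}$ appearing in this order along the diagonal), and let $\gamma_i=(\gamma_{i,0},\dots,\gamma_{i,s_i})$ with $\gamma_{i,l}\in\mathrm{Hom}(\mathbb{F}_q^*,\mathbb{C}^*)$, viewed also as the linear character $\gamma_i(M_0,\dots,M_{s_i})=\prod_l\gamma_{i,l}(\det M_l)$ of $L_i^F$. Let $\mathcal{X}=(R^G_{L_1}(\gamma_1),\dots,R^G_{L_k}(\gamma_k))$ be the corresponding $k$-tuple of Harish-Chandra characters of $\mathrm{GL}_n(\mathbb{F}_q)$, given together with the data $(L_i,\gamma_i)$. Let $I$ be the set of vertices of the star-shaped quiver with $k$ legs: $I$ consists of a central vertex $0=[i,0]$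 (for all $i$) and of vertices $[i,j]$, $1\le i\le k$, $1\le j\le s_i$. Let $(\mathbb{N}^I)^*\subseteq\mathbb{N}^I$ be the set of vectors $\delta$ that are nonincreasing along the legs, i.e. $\delta_{[i,j]}\ge\delta_{[i,j+1]}$ for $0\le j<s_i$. Let $\alpha\in(\mathbb{N}^I)^*$ be given by $\alpha_0=n$ and $\alpha_{[i,j]}=n-\sum_{h=0}^{j-1}n_{i,h}$. Let $\sigma_{\mathcal{X}}\in\mathrm{Hom}(\mathbb{F}_q^*,\mathbb{C}^*)^I$ be given by $(\sigma_{\mathcal{X}})_0=\prod_{i=1}^k\gamma_{i,0}$ and $(\sigma_{\mathcal{X}})_{[i,j]}=\gamma_{i,j}\gamma_{i,j-1}^{-1}$ for $j\ge 1$; for $\delta\in\mathbb{N}^I$ put $\sigma_{\mathcal{X}}^\delta=\prod_{v\in I}(\sigma_{\mathcal{X}})_v^{\delta_v}$, and let $$\mathcal{H}^*_{\sigma_{\mathcal{X}},\alpha}=\{\delta\in(\mathbb{N}^I)^*\mid 0<\delta\le\alpha,\ \sigma_{\mathcal{X}}^\delta=1\},$$ where $\le$ is the componentwise order and $0<\delta$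 means $\delta\neq 0$. The tuple $\mathcal{X}$ is called generic (in the sense of Hausel--Letellier--Rodriguez-Villegas) if for every $F$-stable Levi subgroup $M\subseteq G$ with centre $Z_M$ and all $g_1,\dots,g_k\in\mathrm{GL}_n(\mathbb{F}_q)$ with $Z_M\subseteq g_iL_ig_i^{-1}$ for all $i$, the character $\Gamma_M(z)=\prod_{i=1}^k\gamma_i(g_i^{-1}zg_i)$ of $Z_M^F$ is generic, that is: $\Gamma_M|_{Z_G^F}$ is trivial, and $\Gamma_M|_{Z_{M'}^F}$ is nontrivial for every $F$-stable Levi subgroup $M'$ with $M\subseteq M'\subsetneq G$. Then: 1. If $\mathcal{H}^*_{\sigma_{\mathcal{X}},\alpha}=\{\alpha\}$, then $\mathcal{X}$ is generic. 2. If $\mathcal{X}$ is generic, then there are no $\delta,\epsilon\in\mathcal{H}^*_{\sigma_{\mathcal{X}},\alpha}\setminus\{\alpha\}$ with $\delta+\epsilon=\alpha$. -/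

import Mathlib

noncomputable section

/-! ## Block diagonal subgroups of the general linear group -/

/-- The diagonal idempotent matrix projecting to the coordinates labelled `c`. -/
def labelIdempotent {R ι : Type*} [CommRing R] [DecidableEq ι] {n : ℕ} (p : Fin n → ι) (c : ι) :
    Matrix (Fin n) (Fin n) R :=
  Matrix.diagonal fun a => if p a = c then 1 else 0

theorem blockDiag_iff_commute {R ι : Type*} [CommRing R] [DecidableEq ι] {n : ℕ}
    (p : Fin n → ι) (A : Matrix (Fin n) (Fin n) R) :
    (∀ a b, p a ≠ p b → A a b = 0) ↔ ∀ c, Commute A (labelIdempotent p c) := by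
  constructor
  · intro h c
    ext a b
    simp only [labelIdempotent, Matrix.mul_diagonal, Matrix.diagonal_mul]
    by_cases hab : p a = p b
    · simp [hab]
    · simp [h a b hab]
  · intro h a b hab
    have := congrFun (congrFun (h (p b)).eq a) b
    simpa [labelIdempotent, Matrix.mul_diagonal, Matrix.diagonal_mul, hab] using this

/-- For a labelling `p` of the coordinates, the subgroup of `GL_n(R)` of the matrices that are
block diagonal with respect to the partition of the coordinates into the fibres of `p`. -/
def blockDiag {ι : Type*} [DecidableEq ι] {n : ℕ} (R : Type*) [CommRing R] (p : Fin n → ι) :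
    Subgroup (GL (Fin n) R) where
  carrier := {g | ∀ a b, p a ≠ p b → (g : Matrix (Fin n) (Fin n) R) a b = 0}
  one_mem' := by
    intro a b hab
    have : a ≠ b := fun h => hab (h ▸ rfl)
    simp [Matrix.one_apply_ne this]
  mul_mem' := by
    intro g h hg hh
    simp only [Set.mem_ofPred_eq, blockDiag_iff_commute] at hg hh ⊢
    intro c
    rw [Units.val_mul]
    exact (hg c).mul_left (hh c)
  inv_mem' := by
    intro g hg
    simp only [Set.mem_ofPred_eq, blockDiag_iff_commute] at hg ⊢
    intro c
    exact (hg c).units_inv_left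

/-- The projection from a block diagonal group to the general linear group of one block. -/
def blockProj {ι : Type*} [DecidableEq ι] {n : ℕ} (R : Type*) [CommRing R] (p : Fin n → ι)
    (c : ι) : blockDiag R p →* GL {a : Fin n // p a = c} R :=
  MonoidHom.toHomUnits
    { toFun := fun g => ((g : GL (Fin n) R) : Matrix (Fin n) (Fin n) R).toSquareBlock p c
      map_one' := by
        ext a b
        simp [Matrix.toSquareBlock_def, Matrix.one_apply, Subtype.ext_iff]
      map_mul' := by
        intro g h
        ext a b
        have key : ∑ x, ((g : GL (Fin n) R) : Matrix (Fin n) (Fin n) R) a x *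
              ((h : GL (Fin n) R) : Matrix (Fin n) (Fin n) R) x b =
            ∑ x : {a : Fin n // p a = c}, ((g : GL (Fin n) R) : Matrix (Fin n) (Fin n) R) a x *
              ((h : GL (Fin n) R) : Matrix (Fin n) (Fin n) R) x b := by
          rw [← Finset.sum_subtype (Finset.univ.filter fun x => p x = c) (by simp)
            (fun x => ((g : GL (Fin n) R) : Matrix (Fin n) (Fin n) R) a x *
              ((h : GL (Fin n) R) : Matrix (Fin n) (Fin n) R) x b)]
          refine (Finset.sum_filter_of_ne fun x _ hx => ?_).symm
          by_contra hne
          refine hx ?_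
          rw [g.2 a x (fun hax => hne (hax.symm.trans a.2)), zero_mul]
        simpa [Matrix.toSquareBlock_def, Matrix.mul_apply] using key }

/-- The entrywise action of the inclusion of `K` into an extension `E` on `GL_n`. -/
def glIncl (K E : Type*) [Field K] [Field E] [Algebra K E] (n : ℕ) :
    GL (Fin n) K →* GL (Fin n) E :=
  Matrix.GeneralLinearGroup.map (algebraMap K E)

theorem glIncl_mem_blockDiag {ι : Type*} [DecidableEq ι] {K E : Type*} [Field K] [Field E]
    [Algebra K E] {n : ℕ} (p : Fin n → ι) (g : GL (Fin n) K) :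
    glIncl K E n g ∈ blockDiag E p ↔ g ∈ blockDiag K p := by
  have (a b : Fin n) : (glIncl K E n g : Matrix (Fin n) (Fin n) E) a b = 0 ↔
      (g : Matrix (Fin n) (Fin n) K) a b = 0 := by
    simp [glIncl]
  exact forall₂_congr fun a b => imp_congr_right fun _ => this a b

/-! ## Frobenius, Levi subgroups of `GL_n` over the algebraic closure, rational points

Throughout, `K` is a finite field with `q` elements and `E` an algebraic closure of `K`. -/

/-- The standard Frobenius morphism of `GL_n(E)`, raising all the entries to the power `q`. -/
def glFrob (K E : Type*) [Field K] [Fintype K] [Field E] [Algebra K E] (n : ℕ) :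
    GL (Fin n) E →* GL (Fin n) E :=
  Matrix.GeneralLinearGroup.map (FiniteField.frobeniusAlgHom K E : E →+* E)

/-- `M` is stable under the Frobenius morphism. -/
def IsFrobStable (K : Type*) {E : Type*} [Field K] [Fintype K] [Field E] [Algebra K E] {n : ℕ}
    (M : Subgroup (GL (Fin n) E)) : Prop :=
  M.map (glFrob K E n) = M

/-- The Levi subgroups of `GL_n`: the conjugates of the block diagonal subgroups
`GL_{m_1} × ⋯ × GL_{m_r}` (equivalently, the stabilizers of direct sum decompositions of `E ^ n`).
The labelling need not have intervals as fibres: permuting coordinates is a conjugation. -/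
def IsLevi {E : Type*} [Field E] {n : ℕ} (M : Subgroup (GL (Fin n) E)) : Prop :=
  ∃ (p : Fin n → Fin n) (h : GL (Fin n) E),
    M = (blockDiag E p).map (MulAut.conj h).toMonoidHom

/-- The centre `Z_M` of `M`, as a subgroup of `GL_n(E)`. -/
def centre {E : Type*} [Field E] {n : ℕ} (M : Subgroup (GL (Fin n) E)) :
    Subgroup (GL (Fin n) E) :=
  (Subgroup.center M).map M.subtype

/-- The group of rational points `H^F = H ∩ GL_n(K)`, as a subgroup of `GL_n(K)`. -/
def ratPts (K : Type*) {E : Type*} [Field K] [Field E] [Algebra K E] {n : ℕ}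
    (H : Subgroup (GL (Fin n) E)) : Subgroup (GL (Fin n) K) :=
  H.comap (glIncl K E n)

/-- A linear character `θ` of `Z_M^F` is generic: its restriction to `Z_G^F` is trivial, and for
every Frobenius stable Levi subgroup `M'` with `M ≤ M' ≠ G` its restriction to `Z_{M'}^F` is
nontrivial; here `G = GL_n` is `⊤`.  (One has `Z_{M'} ≤ Z_M` for all such `M'`.) -/
def IsGenericLinearChar {K E : Type*} [Field K] [Fintype K] [Field E] [Algebra K E] {n : ℕ}
    (M : Subgroup (GL (Fin n) E)) (θ : ratPts K (centre M) →* ℂˣ) : Prop :=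
  (∀ z : ratPts K (centre M),
    (z : GL (Fin n) K) ∈ ratPts K (centre (⊤ : Subgroup (GL (Fin n) E))) → θ z = 1) ∧
  ∀ M' : Subgroup (GL (Fin n) E), IsLevi M' → IsFrobStable K M' → M ≤ M' → M' ≠ ⊤ →
    ∃ z : ratPts K (centre M), (z : GL (Fin n) K) ∈ ratPts K (centre M') ∧ θ z ≠ 1

/-! ## Split Levi subgroups with a linear character -/

/-- The data `(L, γ)` defining a Harish-Chandra character `R_L^G(γ)` of `GL_n(K)`: a split Levi
subgroup `L = GL_{n_0} × ⋯ × GL_{n_s}` of `GL_n` and a tuple `γ = (γ_0, …, γ_s)` of linear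
characters of the multiplicative group of `K`. -/
structure HCDatum (K : Type*) [Field K] (n : ℕ) where
  /-- the number of blocks is `s + 1` -/
  s : ℕ
  /-- the sizes `n_0, …, n_s` of the blocks -/
  size : Fin (s + 1) → ℕ
  sum_size : ∑ l, size l = n
  /-- the characters `γ_0, …, γ_s` -/
  γ : Fin (s + 1) → (Kˣ →* ℂˣ)

namespace HCDatum

variable {K : Type*} [Field K] {n : ℕ} (X : HCDatum K n)

/-- The block in which a coordinate lies.  The blocks are consecutive intervals, of sizes
`n_s, n_{s-1}, …, n_0` in this order along the diagonal. -/
def label (a : Fin n) : Fin (X.s + 1) :=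
  (finSigmaFinEquiv (n := fun j => X.size j.rev)).symm
    (Fin.cast (X.sum_size.symm.trans (Equiv.sum_comp Fin.revPerm X.size).symm) a) |>.1.rev

/-- The split Levi subgroup `L`, over a field `E`. -/
def levi (E : Type*) [Field E] : Subgroup (GL (Fin n) E) :=
  blockDiag E X.label

/-- The linear character `γ` of `L^F = GL_{n_0}(K) × ⋯ × GL_{n_s}(K)`,
sending `(M_0, …, M_s)` to `∏_l γ_l (det M_l)`. -/
def leviChar : X.levi K →* ℂˣ :=
  ∏ l, (X.γ l).comp (Matrix.GeneralLinearGroup.det.comp (blockProj K X.label l))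

end HCDatum

/-! ## Generic tuples -/

/-- If `Z_M ≤ g L g⁻¹`, the morphism `Z_M^F → L^F`, `z ↦ g⁻¹ z g`. -/
def conjToLevi {K E : Type*} [Field K] [Field E] [Algebra K E] {n : ℕ} (X : HCDatum K n)
    (M : Subgroup (GL (Fin n) E)) (g : GL (Fin n) K)
    (h : centre M ≤ (X.levi E).map (MulAut.conj (glIncl K E n g)).toMonoidHom) :
    ratPts K (centre M) →* X.levi K :=
  ((MulAut.conj g⁻¹).toMonoidHom.comp (ratPts K (centre M)).subtype).codRestrict (X.levi K) (by
    rintro ⟨z, hz⟩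
    obtain ⟨y, hy, hyz⟩ := h hz
    refine (glIncl_mem_blockDiag (E := E) X.label _).1 ?_
    have : glIncl K E n (g⁻¹ * z * g) = y := by
      simp only [map_mul, map_inv, ← hyz]
      simp [mul_assoc]
    have hy' : y ∈ blockDiag E X.label := hy
    simpa [← this, mul_assoc] using hy')

/-- The character `Γ_M(z) = ∏_i γ_i (g_i⁻¹ z g_i)` of `Z_M^F`. -/
def gammaChar {K E : Type*} [Field K] [Field E] [Algebra K E] {n k : ℕ}
    (X : Fin k → HCDatum K n) (M : Subgroup (GL (Fin n) E)) (g : Fin k → GL (Fin n) K)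
    (h : ∀ i, centre M ≤ ((X i).levi E).map (MulAut.conj (glIncl K E n (g i))).toMonoidHom) :
    ratPts K (centre M) →* ℂˣ :=
  ∏ i, (X i).leviChar.comp (conjToLevi (X i) M (g i) (h i))

/-- The tuple of Harish-Chandra characters `R_{L_i}^G(γ_i)` is generic: for every Frobenius stable
Levi subgroup `M` and `g_1, …, g_k ∈ GL_n(K)` with `Z_M ≤ g_i L_i g_i⁻¹` for all `i`, the character
`Γ_M` of `Z_M^F` is generic. -/
def IsGenericTuple {K : Type*} (E : Type*) [Field K] [Fintype K] [Field E] [Algebra K E]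
    {n k : ℕ} (X : Fin k → HCDatum K n) : Prop :=
  ∀ M : Subgroup (GL (Fin n) E), IsLevi M → IsFrobStable K M →
    ∀ (g : Fin k → GL (Fin n) K)
      (h : ∀ i, centre M ≤ ((X i).levi E).map (MulAut.conj (glIncl K E n (g i))).toMonoidHom),
      IsGenericLinearChar M (gammaChar X M g h)

/-! ## The star-shaped quiver and the set of dimension vectors attached to a tuple -/

/-- The vertices of the star-shaped quiver with `k` legs of lengths `s_1, …, s_k`: the central
vertex `0` is `none`, and the vertex `[i, j + 1]` is `some ⟨i, j⟩`. -/
abbrev StarVertex {k : ℕ} (s : Fin k → ℕ) : Type :=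
  Option (Σ i : Fin k, Fin (s i))

/-- The vertex `[i, j]` for `0 ≤ j ≤ s_i`, where `[i, 0]` is the central vertex. -/
def legVertex {k : ℕ} {s : Fin k → ℕ} (i : Fin k) (j : Fin (s i + 1)) : StarVertex s :=
  Fin.cases none (fun j' => some ⟨i, j'⟩) j

/-- Dimension vectors that are nonincreasing along the legs. -/
def NonincreasingOnLegs {k : ℕ} {s : Fin k → ℕ} (δ : StarVertex s → ℕ) : Prop :=
  ∀ i : Fin k, Antitone fun j : Fin (s i + 1) => δ (legVertex i j)

section Tuple

variable {K : Type*} [Field K] {n k : ℕ} (X : Fin k → HCDatum K n)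

/-- The vertices of the star-shaped quiver attached to the tuple. -/
abbrev TupleVertex : Type := StarVertex fun i => (X i).s

/-- The dimension vector `α`: `α_0 = n` and `α_{[i,j]} = n - ∑_{h < j} n_{i,h}`. -/
def tupleDim : TupleVertex X → ℕ
  | none => n
  | some ⟨i, j⟩ => n - ∑ h ∈ Finset.Iio j.succ, (X i).size h

/-- The element `σ`: `σ_0 = ∏_i γ_{i,0}` and `σ_{[i,j]} = γ_{i,j} γ_{i,j-1}⁻¹` for `j ≥ 1`. -/
def tupleSigma : TupleVertex X → (Kˣ →* ℂˣ)
  | none => ∏ i, (X i).γ 0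
  | some ⟨i, j⟩ => (X i).γ j.succ * ((X i).γ j.castSucc)⁻¹

/-- The set `H*_{σ,α}` of the dimension vectors `δ`, nonincreasing along the legs, such that
`0 < δ ≤ α` and `σ^δ = 1`. -/
def tupleH : Set (TupleVertex X → ℕ) :=
  {δ | NonincreasingOnLegs δ ∧ 0 < δ ∧ δ ≤ tupleDim X ∧ ∏ v, tupleSigma X v ^ δ v = 1}

end Tuple

end

/-! If a nonincreasing vector δ has differences m_{i,l} along leg i, Abel summation gives σ^δ = ∏_i
∏_l γ_{i,l}^{m_{i,l}} (`HasDifferences.prod_tupleSigma`). When m_{i,l} ≤ n_{i,l}, this is the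
character by which a scalar c acts if it occupies m_{i,l} eigenvalues of the l-th block of L_i and
all other eigenvalues are 1. For δ = α it is the value at scalar matrices, whence triviality on
Z_G^F.

For the first claim, a proper F-stable Levi M' commutes with a nonscalar semisimple matrix y over K,
a Galois trace of a multiple of the projection to one summand (`IsLevi.exists_nonscalar_commute`).
Let p be an irreducible factor of its characteristic polynomial, of multiplicity d, so 0 < d < n.
Norms of finite fields are surjective, so by the Chinese remainder theorem each c in K^* admits a
polynomial b with det b(Y) = c^(multiplicity of p) for y and all diagonal blocks Y of its conjugates
g_i⁻¹yg_i (`exists_det_aeval_eq_pow_multiplicity`). If Γ_M were trivial on Z_{M'}^F, its values at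
the elements b(y) would say σ^δ = 1 for the δ whose differences are the multiplicities of p in the
blocks. This δ has δ_0 = d < n, contradicting H* = {α}.

For the second claim, a decomposition α = δ + ε splits each block size as m_{i,l} + m'_{i,l}. Take M
= M' = GL_{δ_0} × GL_{ε_0} and permutation matrices g_i placing the two eigenvalues x, x' of a
central element in the l-th block of L_i with multiplicities m_{i,l}, m'_{i,l}. Then Γ_M = σ^δ(x)
σ^ε(x') = 1 on all of Z_M^F, so the tuple is not generic. -/

noncomputable section

/-! ### Determinants of polynomials in a matrix -/

open Polynomial in
/-- The determinant of a polynomial in a matrix is the product of its values at the eigenvalues. -/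
theorem det_aeval_eq_prod_roots_charpoly {F m : Type*} [Field F] [IsAlgClosed F] [Fintype m]
    [DecidableEq m] (A : Matrix m m F) (b : F[X]) :
    (aeval A b).det = (A.charpoly.roots.map fun r => b.eval r).prod := by
  have hA : A.charpoly = (A.charpoly.roots.map fun r => X - C r).prod := by
    have := (IsAlgClosed.splits A.charpoly).eq_prod_roots
    rwa [A.charpoly_monic.leadingCoeff, C_1, one_mul] at this
  have hcard : Multiset.card A.charpoly.roots = Fintype.card m := by
    rw [← (IsAlgClosed.splits A.charpoly).natDegree_eq_card_roots, A.charpoly_natDegree_eq_dim]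
  -- Both sides are multiplicative in b, and b splits over F: only constants and linear factors
  -- remain, the latter being values of the characteristic polynomial up to sign.
  let f : F[X] →* F :=
    Matrix.detMonoidHom.comp ((aeval A : F[X] →ₐ[F] Matrix m m F) : F[X] →* Matrix m m F)
  have hf (p : F[X]) : f p = (aeval A p).det := rfl
  let g : F[X] →* F :=
    { toFun := fun p => (A.charpoly.roots.map fun r => p.eval r).prod
      map_one' := by simp
      map_mul' := fun p q => by simp [Multiset.prod_map_mul] }
  have hg (p : F[X]) : g p = (A.charpoly.roots.map fun r => p.eval r).prod := rfl
  have hC (c : F) : f (C c) = g (C c) := by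
    rw [hf, hg]
    simp [hcard, Matrix.algebraMap_eq_diagonal, Pi.algebraMap_def]
  have hX (c : F) : f (X - C c) = g (X - C c) := by
    have h1 : aeval A (X - C c) = -(Matrix.scalar m c - A) := by
      simp [Matrix.algebraMap_eq_diagonal, Pi.algebraMap_def]
    rw [hf, hg, h1, Matrix.det_neg, ← Matrix.eval_charpoly]
    conv_lhs => rw [hA]
    rw [eval_multiset_prod, Multiset.map_map, ← hcard,
      ← Multiset.card_map (eval c ∘ fun r => X - C r) A.charpoly.roots, ← Multiset.prod_map_neg,
      Multiset.map_map]
    simp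
  rw [← hf, ← hg, (IsAlgClosed.splits b).eq_prod_roots, map_mul, map_mul, hC,
    map_multiset_prod, map_multiset_prod, Multiset.map_map, Multiset.map_map]
  congr 2
  exact Multiset.map_congr rfl fun c _ => hX c

-- Spectral mapping: an eigenvalue r of A makes Q(r) an eigenvalue of Q(A) = 0.
open Polynomial in
theorem eval_eq_zero_of_isRoot_charpoly {F m : Type*} [Field F] [Fintype m]
    [DecidableEq m] (A : Matrix m m F) {Q : F[X]} (hQ : aeval A Q = 0) {r : F}
    (hr : r ∈ A.charpoly.roots) : Q.eval r = 0 := by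
  have h1 : r ∈ spectrum F A := Matrix.mem_spectrum_iff_isRoot_charpoly.2 (isRoot_of_mem_roots hr)
  have h2 := spectrum.subset_polynomial_aeval A Q ⟨r, h1, rfl⟩
  rw [hQ] at h2
  have : Nontrivial (Matrix m m F) := by
    by_contra h
    rw [not_nontrivial_iff_subsingleton] at h
    simp at h1
  simpa using h2

open Polynomial in
/-- Norms from the residue field of `π`, as a product over the roots of `π`. -/
theorem exists_prod_aroots_eq {K : Type*} [Field K] [Finite K] {p : K[X]} (hp : Irreducible p)
    (E : Type*) [Field E] [Algebra K E] [IsAlgClosed E] (c : K) :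
    ∃ a : K[X], ((p.aroots E).map fun r => aeval r a).prod = algebraMap K E c := by
  have : Fact (Irreducible p) := ⟨hp⟩
  have : Module.Finite K (AdjoinRoot p) := (AdjoinRoot.powerBasis hp.ne_zero).finite
  have : Finite (AdjoinRoot p) := Module.finite_of_finite K
  -- Surjectivity of the norm lets every c occur, whatever the degree of p; so p counts by its
  -- multiplicity alone, not by multiplicity times degree.
  obtain ⟨x, hx⟩ := FiniteField.norm_surjective K (AdjoinRoot p) c
  obtain ⟨a, rfl⟩ := AdjoinRoot.mk_surjective x
  refine ⟨a, ?_⟩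
  classical
  rw [← hx, Algebra.norm_eq_prod_embeddings K E]
  have hnd : (p.aroots E).Nodup := nodup_aroots_iff_of_splits hp.ne_zero
    (IsAlgClosed.splits _) |>.2 (PerfectField.separable_of_irreducible hp)
  rw [← Equiv.prod_comp (AdjoinRoot.equiv E K p hp.ne_zero).symm]
  have h1 (r : {x // x ∈ p.aroots E}) :
      ((AdjoinRoot.equiv E K p hp.ne_zero).symm r) (AdjoinRoot.mk p a) = aeval (r : E) a := by
    obtain ⟨σ, rfl⟩ := (AdjoinRoot.equiv E K p hp.ne_zero).surjective r
    rw [Equiv.symm_apply_apply]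
    have : ((AdjoinRoot.equiv E K p hp.ne_zero σ : {x // x ∈ p.aroots E}) : E)
        = σ (AdjoinRoot.root p) := rfl
    rw [this, aeval_algHom_apply, AdjoinRoot.aeval_eq]
  simp_rw [h1]
  let s : Finset E := ⟨p.aroots E, hnd⟩
  have h2 : ((p.aroots E).map fun r => aeval r a).prod = ∏ r ∈ s, aeval r a := rfl
  rw [h2]
  exact (Finset.prod_subtype (p := fun x => x ∈ p.aroots E) s (fun _ => Iff.rfl)
    fun r => aeval r a)

open Polynomial in
/-- Let `p` be an irreducible factor of a separable polynomial `Q` over a finite field, and `c` an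
element of the field.  There is a polynomial `b` such that `det (b(Y)) = c ^ m` for all matrices
`Y` annihilated by `Q`, where `m` is the multiplicity of `p` in the characteristic polynomial. -/
theorem exists_det_aeval_eq_pow_multiplicity {K : Type*} [Field K] [Finite K] {p Q : K[X]}
    (hp : Irreducible p) (hQ : Q.Separable) (hpQ : p ∣ Q) (c : K) :
    ∃ b : K[X], ∀ {m : Type} [Fintype m] [DecidableEq m] (Y : Matrix m m K), aeval Y Q = 0 →
      (aeval Y b).det = c ^ multiplicity p Y.charpoly := by
  obtain ⟨ρ, rfl⟩ := hpQ
  obtain ⟨u, v, huv⟩ := hQ.isCoprime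
  let E := AlgebraicClosure K
  obtain ⟨a, ha⟩ := exists_prod_aroots_eq hp E c
  -- Chinese remainder theorem: b ≡ a mod p and b ≡ 1 mod ρ. The choice does not depend on Y.
  refine ⟨a * (v * ρ) + u * p, fun {m} _ _ Y hY => ?_⟩
  set b := a * (v * ρ) + u * p with hb
  have hfin : FiniteMultiplicity p Y.charpoly :=
    FiniteMultiplicity.of_not_isUnit hp.not_isUnit Y.charpoly_monic.ne_zero
  obtain ⟨τ, hτ, hpτ⟩ := hfin.exists_eq_pow_mul_and_not_dvd
  have hτ0 : τ ≠ 0 := by rintro rfl; simp at hpτ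
  set d := multiplicity p Y.charpoly with hd
  have hev (r : E) : aeval r u * aeval r p + aeval r v * aeval r ρ = 1 := by
    simpa using congrArg (aeval r) huv
  have hbp (r : E) (hr : aeval r p = 0) : aeval r b = aeval r a := by
    have := hev r
    rw [hr, mul_zero, zero_add] at this
    simp [hb, hr, this]
  have hbρ (r : E) (hr : aeval r ρ = 0) : aeval r b = 1 := by
    have := hev r
    rw [hr, mul_zero, add_zero] at this
    simp [hb, hr, this]
  apply FaithfulSMul.algebraMap_injective K E
  have h1 : algebraMap K E (aeval Y b).det =
      (aeval (Y.map (algebraMap K E)) (b.map (algebraMap K E))).det := by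
    rw [RingHom.map_det, aeval_map_algebraMap]
    congr 1
    exact (aeval_algHom_apply ((Algebra.ofId K E).mapMatrix (m := m)) Y b).symm
  have hY' : aeval (Y.map (algebraMap K E)) ((p * ρ).map (algebraMap K E)) = 0 := by
    rw [aeval_map_algebraMap]
    have := aeval_algHom_apply ((Algebra.ofId K E).mapMatrix (m := m)) Y (p * ρ)
    rw [hY, map_zero] at this
    exact this
  rw [h1, det_aeval_eq_prod_roots_charpoly]
  have hroots : (Y.map (algebraMap K E)).charpoly.roots = d • p.aroots E + τ.aroots E := by
    rw [Matrix.charpoly_map, ← aroots_def, hτ,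
      aroots_mul (mul_ne_zero (pow_ne_zero _ hp.ne_zero) hτ0), aroots_pow]
  have hval := fun r hr => eval_eq_zero_of_isRoot_charpoly _ hY' (r := r) hr
  rw [hroots] at hval ⊢
  simp only [eval_map_algebraMap] at hval ⊢
  rw [Multiset.map_add, Multiset.prod_add, Multiset.map_nsmul, Multiset.prod_nsmul]
  have h2 : ((p.aroots E).map fun r => aeval r b).prod = algebraMap K E c := by
    rw [← ha]
    exact congrArg _ (Multiset.map_congr rfl fun r hr => hbp r (mem_aroots.1 hr).2)
  have h3 : ((τ.aroots E).map fun r => aeval r b).prod = 1 := by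
    refine Multiset.prod_eq_one fun x hx => ?_
    obtain ⟨r, hr, rfl⟩ := Multiset.mem_map.1 hx
    have h4 := hval r (Multiset.mem_add.2 (Or.inr hr))
    rw [map_mul, mul_eq_zero] at h4
    -- A root of τ is an eigenvalue of Y, hence a root of p or ρ; a root of p would force p ∣ τ.
    refine hbρ r (h4.resolve_left fun h5 => hpτ ?_)
    have h6 := minpoly.dvd K r (mem_aroots.1 hr).2
    rw [← minpoly.eq_of_irreducible hp h5] at h6
    exact dvd_of_mul_right_dvd h6
  rw [h2, h3, mul_one, map_pow]

/-! ### Descent from the algebraic closure -/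

open IntermediateField in
theorem exists_finite_intermediateField {K E ι : Type*} [Field K] [Finite K] [Field E] [Algebra K E]
    [Algebra.IsAlgebraic K E] [Finite ι] (f : ι → E) :
    ∃ L : IntermediateField K E, Finite L ∧ ∀ i, f i ∈ L := by
  refine ⟨adjoin K (Set.range f), ?_, fun i => subset_adjoin _ _ ⟨i, rfl⟩⟩
  have : FiniteDimensional K (adjoin K (Set.range f)) :=
    finiteDimensional_adjoin fun x _ => Algebra.IsIntegral.isIntegral x
  exact Module.finite_of_finite K

-- All values lie in one finite field L, on which the separable polynomial X^|L| - X vanishes.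
open Polynomial in
theorem exists_separable_annihilator {K E ι : Type*} [Field K] [Finite K] [Field E] [Algebra K E]
    [Algebra.IsAlgebraic K E] [Finite ι] (f : ι → E) :
    ∃ Q : K[X], Q.Separable ∧ ∀ i, aeval (f i) Q = 0 := by
  obtain ⟨L, hL, hf⟩ := exists_finite_intermediateField (K := K) f
  have := Fintype.ofFinite L
  obtain ⟨p, hp⟩ := CharP.exists K
  have : CharP L p := charP_of_injective_algebraMap (algebraMap K L).injective p
  refine ⟨X ^ Fintype.card L - X, galois_poly_separable p _ ?_, fun i => ?_⟩
  · rw [← CharP.cast_eq_zero_iff L p]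
    exact Nat.cast_card_eq_zero L
  · have := congrArg (algebraMap L E) (FiniteField.pow_card (⟨f i, hf i⟩ : L))
    rw [map_pow] at this
    simpa [sub_eq_zero] using this

/-- A nonscalar matrix `P` over the algebraic closure has a multiple whose sum over a Galois orbit
is a nonscalar matrix over the finite field. -/
theorem exists_nonscalar_descent {K E m : Type*} [Field K] [Fintype K] [Field E] [Algebra K E]
    [Algebra.IsAlgebraic K E] [Fintype m] [DecidableEq m] (P : Matrix m m E)
    (hP : ¬ ∃ c, P = Matrix.scalar m c) :
    ∃ (y : Matrix m m K) (t : E) (d : ℕ), (¬ ∃ c, y = Matrix.scalar m c) ∧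
      y.map (algebraMap K E) =
        ∑ j ∈ Finset.range d, (t • P).map fun x => x ^ Fintype.card K ^ j := by
  obtain ⟨L, hL, hf⟩ := exists_finite_intermediateField (K := K) fun ab : m × m => P ab.1 ab.2
  have : Module.Finite K L := Module.Finite.of_finite
  let P' : m → m → L := fun a b => ⟨P a b, hf (a, b)⟩
  -- If the traces of tP were scalar for every t, nondegeneracy of the trace form would kill the
  -- off-diagonal entries and the differences of diagonal entries of P.
  have key : ∃ t : L, ¬ ∃ c, (Matrix.of fun a b => Algebra.trace K L (t * P' a b)) =
      Matrix.scalar m c := by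
    by_contra! hall
    have hnd (x : L) (hx : ∀ t, Algebra.trace K L (t * x) = 0) : x = 0 := by
      refine (traceForm_nondegenerate K L).1 x fun t => ?_
      rw [Algebra.traceForm_apply, mul_comm]
      exact hx t
    have h1 (a b) (hab : a ≠ b) : P' a b = 0 := hnd _ fun t => by
      obtain ⟨c, hc⟩ := hall t
      have := congrFun (congrFun hc a) b
      simpa [hab] using this
    have h2 (a b) : P' a a = P' b b := sub_eq_zero.1 <| hnd _ fun t => by
      obtain ⟨c, hc⟩ := hall t
      have ha := congrFun (congrFun hc a) a
      have hb := congrFun (congrFun hc b) b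
      simp at ha hb
      rw [mul_sub, map_sub, ha, hb, sub_self]
    apply hP
    rcases isEmpty_or_nonempty m with h | ⟨⟨a⟩⟩
    · exact ⟨0, Subsingleton.elim _ _⟩
    · refine ⟨P a a, Matrix.ext fun b c => ?_⟩
      by_cases hbc : b = c
      · subst hbc
        simpa [P'] using congrArg Subtype.val (h2 b a)
      · simpa [P', hbc] using congrArg Subtype.val (h1 b c hbc)
  obtain ⟨t, ht⟩ := key
  refine ⟨_, t, Module.finrank K L, ht, Matrix.ext fun a b => ?_⟩
  have h3 := congrArg (algebraMap L E)
    (FiniteField.algebraMap_trace_eq_sum_pow K L (t * P' a b))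
  rw [← IsScalarTower.algebraMap_apply] at h3
  rw [Matrix.map_apply, Matrix.of_apply, h3, Matrix.sum_apply, map_sum]
  simp [P']

/-! ### Centralizers and centres of Levi subgroups -/

/-- The invertible diagonal matrix with given entries. -/
def diagGL {R : Type*} [CommRing R] {n : ℕ} (f : Fin n → Rˣ) : GL (Fin n) R :=
  ⟨Matrix.diagonal fun a => (f a : R), Matrix.diagonal fun a => ((f a)⁻¹ : Rˣ),
    by simp [Matrix.diagonal_mul_diagonal], by simp [Matrix.diagonal_mul_diagonal]⟩

@[simp]
theorem coe_diagGL {R : Type*} [CommRing R] {n : ℕ} (f : Fin n → Rˣ) :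
    (diagGL f : Matrix (Fin n) (Fin n) R) = Matrix.diagonal fun a => (f a : R) := rfl

theorem diagGL_mem_blockDiag {R ι : Type*} [CommRing R] [DecidableEq ι] {n : ℕ} (f : Fin n → Rˣ)
    (p : Fin n → ι) : diagGL f ∈ blockDiag R p := fun a b hab => by
  have : a ≠ b := fun h => hab (h ▸ rfl)
  simp [this]

/-- An elementary matrix. -/
def elemGL (R : Type*) [CommRing R] {n : ℕ} (a b : Fin n) (hab : a ≠ b) : GL (Fin n) R :=
  ⟨Matrix.transvection a b 1, Matrix.transvection a b (-1),
    by simp [Matrix.transvection_mul_transvection_same a b hab],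
    by simp [Matrix.transvection_mul_transvection_same a b hab]⟩

theorem coe_elemGL {R : Type*} [CommRing R] {n : ℕ} (a b : Fin n) (hab : a ≠ b) :
    ((elemGL R a b hab : GL (Fin n) R) : Matrix (Fin n) (Fin n) R) = 1 + Matrix.single a b 1 := rfl

theorem elemGL_mem_blockDiag {R ι : Type*} [CommRing R] [DecidableEq ι] {n : ℕ} {a b : Fin n}
    (hab : a ≠ b) {p : Fin n → ι} (hp : p a = p b) : elemGL R a b hab ∈ blockDiag R p := by
  intro c d hcd
  have : c ≠ d := fun h => hcd (h ▸ rfl)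
  rw [coe_elemGL, Matrix.add_apply, Matrix.one_apply_ne this, zero_add, Matrix.single_apply,
    if_neg]
  rintro ⟨rfl, rfl⟩
  exact hcd hp

theorem exists_unit_ne_one (E : Type*) [Field E] [Infinite E] : ∃ u : Eˣ, (u : E) ≠ 1 := by
  classical
  obtain ⟨x, hx⟩ := Infinite.exists_notMem_finset ({0, 1} : Finset E)
  simp only [Finset.mem_insert, Finset.mem_singleton, not_or] at hx
  exact ⟨Units.mk0 x hx.1, hx.2⟩

section Centralizer

variable {E ι : Type*} [Field E] [DecidableEq ι] {n : ℕ} {p : Fin n → ι}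
  {w : Matrix (Fin n) (Fin n) E}

theorem diag_eq_of_commute_blockDiag
    (hw : ∀ g ∈ blockDiag E p, Commute w (g : Matrix (Fin n) (Fin n) E)) {a b : Fin n}
    (hab : p a = p b) : w a a = w b b := by
  by_cases h : a = b
  · rw [h]
  have := hw _ (elemGL_mem_blockDiag h hab)
  rw [coe_elemGL] at this
  refine Matrix.diag_eq_of_commute_single (Commute.symm ?_)
  simpa using this.sub_right (Commute.one_right w)

/-- Compare with a diagonal matrix having a single entry u ≠ 1. Over the field with two elements no
such u exists. -/
theorem eq_zero_of_commute_blockDiag [Infinite E]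
    (hw : ∀ g ∈ blockDiag E p, Commute w (g : Matrix (Fin n) (Fin n) E)) {a b : Fin n}
    (hab : a ≠ b) : w a b = 0 := by
  obtain ⟨u, hu⟩ := exists_unit_ne_one E
  have := congrFun (congrFun
    (hw _ (diagGL_mem_blockDiag (Function.update (fun _ => 1) a u) p)).eq a) b
  rw [coe_diagGL, Matrix.mul_diagonal, Matrix.diagonal_mul, Function.update_self,
    Function.update_of_ne hab.symm] at this
  by_contra h
  rw [Units.val_one, mul_one] at this
  exact hu (mul_right_cancel₀ h (by rw [one_mul, ← this]))

theorem eq_diagonal_of_commute_blockDiag [Infinite E]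
    (hw : ∀ g ∈ blockDiag E p, Commute w (g : Matrix (Fin n) (Fin n) E)) :
    w = Matrix.diagonal fun a => w a a := by
  ext a b
  by_cases hab : a = b
  · simp [hab]
  · simp [hab, eq_zero_of_commute_blockDiag hw hab]

end Centralizer

theorem mem_centre {E : Type*} [Field E] {n : ℕ} {M : Subgroup (GL (Fin n) E)}
    {z : GL (Fin n) E} : z ∈ centre M ↔ z ∈ M ∧ ∀ g ∈ M, Commute z g := by
  simp only [centre, Subgroup.mem_map, Subgroup.mem_center_iff, Subgroup.coe_subtype,
    Subtype.exists, exists_and_right, exists_eq_right, Subtype.forall, Subtype.ext_iff,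
    MulMemClass.mk_mul_mk, exists_prop]
  exact and_congr_right fun _ => forall₂_congr fun g _ => ⟨fun h => h.symm, fun h => h.symm⟩

/-- A Levi subgroup contains its centralizer: it contains a conjugate of the diagonal torus, whose
centralizer is diagonal. -/
theorem IsLevi.mem_centre_iff {E : Type*} [Field E] [Infinite E] {n : ℕ}
    {M : Subgroup (GL (Fin n) E)} (hM : IsLevi M) {z : GL (Fin n) E} :
    z ∈ centre M ↔ ∀ g ∈ M, Commute z g := by
  refine mem_centre.trans ⟨fun h => h.2, fun h => ⟨?_, h⟩⟩
  obtain ⟨p, x, rfl⟩ := hM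
  have h1 : ∀ g ∈ blockDiag E p,
      Commute ((x⁻¹ * z * x : GL (Fin n) E) : Matrix (Fin n) (Fin n) E) g := fun g hg => by
    have h2 : Commute (x⁻¹ * z * x) g := by
      have := h _ ⟨g, hg, rfl⟩
      have h3 := Commute.map this (MulAut.conj x⁻¹).toMonoidHom
      simpa [mul_assoc] using h3
    exact h2.map (Units.coeHom _)
  refine ⟨x⁻¹ * z * x, fun a b hab => eq_zero_of_commute_blockDiag h1 fun h => hab (h ▸ rfl), ?_⟩
  simp [mul_assoc]

theorem IsLevi.centre_le_centre {E : Type*} [Field E] [Infinite E] {n : ℕ}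
    {M M' : Subgroup (GL (Fin n) E)} (hM : IsLevi M) (hMM' : M ≤ M') :
    centre M' ≤ centre M := fun _ hz =>
  hM.mem_centre_iff.2 fun g hg => (mem_centre.1 hz).2 g (hMM' hg)

/-! ### Dimension vectors and their differences along the legs -/

/-- Abel summation, with D continued by 0 beyond the end of the leg. -/
theorem prod_pow_eq_of_differences {A : Type*} [CommGroup A] {s : ℕ} (γ : Fin (s + 1) → A)
    (m D : Fin (s + 1) → ℕ) (hD : ∀ j : Fin s, D j.castSucc = m j.castSucc + D j.succ)
    (hlast : D (Fin.last s) = m (Fin.last s)) :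
    γ 0 ^ D 0 * ∏ j : Fin s, (γ j.succ * (γ j.castSucc)⁻¹) ^ D j.succ = ∏ l, γ l ^ m l := by
  have h1 : ∏ l, γ l ^ D l = γ 0 ^ D 0 * ∏ j : Fin s, γ j.succ ^ D j.succ :=
    Fin.prod_univ_succ _
  have h2 : ∏ l, γ l ^ D l = (∏ l, γ l ^ m l) * ∏ j : Fin s, γ j.castSucc ^ D j.succ := by
    rw [Fin.prod_univ_castSucc, Fin.prod_univ_castSucc (fun l => γ l ^ m l), hlast]
    simp_rw [hD, pow_add, Finset.prod_mul_distrib]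
    exact mul_right_comm _ _ _
  simp_rw [mul_pow, inv_pow, Finset.prod_mul_distrib, Finset.prod_inv_distrib]
  rw [← mul_assoc, ← h1, h2, mul_inv_cancel_right]

theorem sum_eq_of_differences {s : ℕ} (m D : Fin (s + 1) → ℕ)
    (hD : ∀ j : Fin s, D j.castSucc = m j.castSucc + D j.succ)
    (hlast : D (Fin.last s) = m (Fin.last s)) : D 0 = ∑ l, m l := by
  have h1 : ∑ l, D l = D 0 + ∑ j : Fin s, D j.succ := Fin.sum_univ_succ _
  have h2 : ∑ l, D l = (∑ l, m l) + ∑ j : Fin s, D j.succ := by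
    rw [Fin.sum_univ_castSucc, Fin.sum_univ_castSucc (fun l => m l), hlast]
    simp_rw [hD, Finset.sum_add_distrib]
    omega
  omega

theorem sum_Ici_castSucc {s : ℕ} (m : Fin (s + 1) → ℕ) (j : Fin s) :
    ∑ l ∈ Finset.Ici j.castSucc, m l = m j.castSucc + ∑ l ∈ Finset.Ici j.succ, m l := by
  have : Finset.Ici j.castSucc = insert j.castSucc (Finset.Ici j.succ) := by
    ext l
    simp only [Finset.mem_Ici, Finset.mem_insert, Fin.le_def, Fin.ext_iff, Fin.val_castSucc,
      Fin.val_succ]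
    omega
  rw [this, Finset.sum_insert]
  simp [Fin.le_def]

theorem sum_Ici_last {s : ℕ} (m : Fin (s + 1) → ℕ) :
    ∑ l ∈ Finset.Ici (Fin.last s), m l = m (Fin.last s) := by
  have : Finset.Ici (Fin.last s) = {Fin.last s} := by
    ext l
    simp [Fin.last_le_iff]
  simp [this]

section Tuple

variable {K : Type*} [Field K] {n k : ℕ} (X : Fin k → HCDatum K n)

/-- `m i l` are the differences of the dimension vector `δ` along the legs. -/
def HasDifferences (δ : TupleVertex X → ℕ) (m : ∀ i, Fin ((X i).s + 1) → ℕ) : Prop :=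
  ∀ i, (∀ j : Fin (X i).s,
    δ (legVertex i j.castSucc) = m i j.castSucc + δ (legVertex i j.succ)) ∧
    δ (legVertex i (Fin.last _)) = m i (Fin.last _)

variable {X}

theorem HasDifferences.prod_tupleSigma {δ : TupleVertex X → ℕ} {m : ∀ i, Fin ((X i).s + 1) → ℕ}
    (h : HasDifferences X δ m) :
    ∏ v, tupleSigma X v ^ δ v = ∏ i, ∏ l, (X i).γ l ^ m i l := by
  rw [Fintype.prod_option, Fintype.prod_sigma]
  simp only [tupleSigma]
  rw [← Finset.prod_pow, ← Finset.prod_mul_distrib]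
  refine Finset.prod_congr rfl fun i _ => ?_
  exact prod_pow_eq_of_differences (X i).γ (m i) (fun j => δ (legVertex i j)) (h i).1 (h i).2

theorem HasDifferences.sum_eq {δ : TupleVertex X → ℕ} {m : ∀ i, Fin ((X i).s + 1) → ℕ}
    (h : HasDifferences X δ m) (i : Fin k) : δ none = ∑ l, m i l :=
  sum_eq_of_differences (m i) (fun j => δ (legVertex i j)) (h i).1 (h i).2

theorem HasDifferences.nonincreasing {δ : TupleVertex X → ℕ} {m : ∀ i, Fin ((X i).s + 1) → ℕ}
    (h : HasDifferences X δ m) : NonincreasingOnLegs δ := fun i =>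
  Fin.antitone_iff_succ_le.2 fun j => by
    rw [(h i).1 j]
    exact Nat.le_add_left _ _

theorem hasDifferences_of_nonincreasing {δ : TupleVertex X → ℕ} (h : NonincreasingOnLegs δ) :
    HasDifferences X δ fun i => Fin.lastCases (δ (legVertex i (Fin.last _)))
      fun j => δ (legVertex i j.castSucc) - δ (legVertex i j.succ) := fun i => by
  refine ⟨fun j => ?_, by simp⟩
  have := Fin.antitone_iff_succ_le.1 (h i) j
  simp only [Fin.lastCases_castSucc]
  omega

/-- The dimension vector with given differences along the legs. -/
theorem exists_hasDifferences (m : ∀ i, Fin ((X i).s + 1) → ℕ) (d : ℕ)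
    (hd : ∀ i, d = ∑ l, m i l) :
    ∃ δ : TupleVertex X → ℕ, δ none = d ∧ HasDifferences X δ m := by
  let δ : TupleVertex X → ℕ
    | none => d
    | some ⟨i, j⟩ => ∑ l ∈ Finset.Ici j.succ, m i l
  have hδ (i) (j : Fin ((X i).s + 1)) : δ (legVertex i j) = ∑ l ∈ Finset.Ici j, m i l := by
    refine Fin.cases ?_ (fun j => rfl) j
    have : Finset.Ici (0 : Fin ((X i).s + 1)) = Finset.univ := by ext; simp
    rw [this]
    exact hd i
  refine ⟨δ, rfl, fun i => ⟨fun j => ?_, ?_⟩⟩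
  · rw [hδ, hδ, sum_Ici_castSucc]
  · rw [hδ, sum_Ici_last]

theorem HasDifferences.add {δ ε : TupleVertex X → ℕ} {m m' : ∀ i, Fin ((X i).s + 1) → ℕ}
    (h : HasDifferences X δ m) (h' : HasDifferences X ε m') :
    HasDifferences X (δ + ε) fun i l => m i l + m' i l := fun i => by
  refine ⟨fun j => ?_, ?_⟩
  · simp only [Pi.add_apply, (h i).1 j, (h' i).1 j]
    omega
  · simp only [Pi.add_apply, (h i).2, (h' i).2]

theorem HasDifferences.unique {δ : TupleVertex X → ℕ} {m m' : ∀ i, Fin ((X i).s + 1) → ℕ}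
    (h : HasDifferences X δ m) (h' : HasDifferences X δ m') : m = m' := by
  funext i l
  refine Fin.lastCases ?_ (fun j => ?_) l
  · rw [← (h i).2, ← (h' i).2]
  · have := (h i).1 j
    have := (h' i).1 j
    omega

/-- Sum the differences from the end of each leg. The central vertex needs its own hypothesis
because there may be no legs. -/
theorem HasDifferences.le {δ ε : TupleVertex X → ℕ} {m m' : ∀ i, Fin ((X i).s + 1) → ℕ}
    (h : HasDifferences X δ m) (h' : HasDifferences X ε m') (hm : ∀ i l, m i l ≤ m' i l)
    (h0 : δ none ≤ ε none) : δ ≤ ε := by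
  have key (i) (j : Fin ((X i).s + 1)) : δ (legVertex i j) ≤ ε (legVertex i j) := by
    refine Fin.reverseInduction ?_ (fun j ih => ?_) j
    · rw [(h i).2, (h' i).2]
      exact hm _ _
    · rw [(h i).1, (h' i).1]
      exact add_le_add (hm _ _) ih
  rintro (_ | ⟨i, j⟩)
  · exact h0
  · exact key i j.succ

theorem tupleDim_legVertex (i : Fin k) (j : Fin ((X i).s + 1)) :
    tupleDim X (legVertex i j) = n - ∑ h ∈ Finset.Iio j, (X i).size h := by
  refine Fin.cases ?_ (fun j => rfl) j
  have : Finset.Iio (0 : Fin ((X i).s + 1)) = ∅ := by ext; simp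
  rw [this, Finset.sum_empty]
  rfl

theorem hasDifferences_tupleDim : HasDifferences X (tupleDim X) fun i => (X i).size := fun i => by
  -- Ensures that the subtractions in `tupleDim` are not truncated.
  have hle (t : Finset (Fin ((X i).s + 1))) : ∑ h ∈ t, (X i).size h ≤ n := by
    conv_rhs => rw [← (X i).sum_size]
    exact Finset.sum_le_sum_of_subset (Finset.subset_univ _)
  refine ⟨fun j => ?_, ?_⟩
  · rw [tupleDim_legVertex, tupleDim_legVertex]
    have : Finset.Iio j.succ = insert j.castSucc (Finset.Iio j.castSucc) := by
      ext l
      simp only [Finset.mem_Iio, Finset.mem_insert, Fin.lt_def, Fin.ext_iff, Fin.val_castSucc,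
        Fin.val_succ]
      omega
    have h1 := hle (Finset.Iio j.succ)
    rw [this, Finset.sum_insert (by simp)] at h1 ⊢
    dsimp only
    omega
  · rw [tupleDim_legVertex]
    have h1 : Finset.univ = insert (Fin.last _) (Finset.Iio (Fin.last (X i).s)) := by
      ext l
      simp only [Finset.mem_Iio, Finset.mem_insert, Finset.mem_univ, true_iff]
      exact (Fin.le_last l).eq_or_lt
    have h2 := (X i).sum_size
    rw [h1, Finset.sum_insert (by simp)] at h2
    dsimp only
    omega

end Tuple

/-! ### The linear character of a split Levi subgroup -/

namespace HCDatum

variable {K : Type*} [Field K] {n : ℕ} (X : HCDatum K n)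

theorem card_label (l : Fin (X.s + 1)) : Fintype.card {a : Fin n // X.label a = l} = X.size l := by
  have hn : n = ∑ j : Fin (X.s + 1), X.size j.rev :=
    X.sum_size.symm.trans (Equiv.sum_comp Fin.revPerm X.size).symm
  have e : {a : Fin n // X.label a = l} ≃
      {x : Σ j : Fin (X.s + 1), Fin (X.size j.rev) // x.1 = l.rev} :=
    ((finCongr hn).trans
      (finSigmaFinEquiv (n := fun j => X.size j.rev)).symm).subtypeEquiv fun a =>
      Fin.rev_eq_iff
  rw [Fintype.card_congr (e.trans (Equiv.sigmaSubtype _)), Fintype.card_fin, Fin.rev_rev]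

theorem leviChar_apply (g : X.levi K) : X.leviChar g =
    ∏ l, X.γ l (Matrix.GeneralLinearGroup.det (blockProj K X.label l g)) := by
  rw [leviChar, MonoidHom.finsetProd_apply]
  rfl

theorem coe_blockProj (g : X.levi K) (l : Fin (X.s + 1)) :
    (blockProj K X.label l g : Matrix {a // X.label a = l} {a // X.label a = l} K) =
      ((g : GL (Fin n) K) : Matrix (Fin n) (Fin n) K).toSquareBlock X.label l := rfl

theorem leviChar_of_eq_diagGL {g : X.levi K} {f : Fin n → Kˣ} (hg : (g : GL (Fin n) K) = diagGL f) :
    X.leviChar g = ∏ l, X.γ l (∏ a : {a // X.label a = l}, f a) := by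
  rw [leviChar_apply]
  refine Finset.prod_congr rfl fun l _ => congrArg _ (Units.ext ?_)
  rw [Matrix.GeneralLinearGroup.val_det_apply, coe_blockProj, hg]
  have : (diagGL f : Matrix (Fin n) (Fin n) K).toSquareBlock X.label l =
      Matrix.diagonal fun a : {a // X.label a = l} => (f a : K) := by
    ext a b
    simp [Matrix.toSquareBlock_def, Matrix.diagonal_apply, Subtype.ext_iff]
  rw [this, Matrix.det_diagonal, Units.coe_prod]

end HCDatum

/-! ### Multiplicities in characteristic polynomials -/

section Multiplicity

open Polynomial

variable {K : Type*} [Field K]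

theorem multiplicity_le_natDegree {p f : K[X]} (hp : Irreducible p) (hf : f ≠ 0) :
    multiplicity p f ≤ f.natDegree := by
  have h := natDegree_le_of_dvd (pow_multiplicity_dvd p f) hf
  rw [natDegree_pow] at h
  exact (Nat.le_mul_of_pos_right _ hp.natDegree_pos).trans h

theorem multiplicity_prod {ι : Type*} {p : K[X]} (hp : Irreducible p) (s : Finset ι) (f : ι → K[X])
    (hf : ∀ i ∈ s, f i ≠ 0) : multiplicity p (∏ i ∈ s, f i) = ∑ i ∈ s, multiplicity p (f i) := by
  have h (q : K[X]) (hq : q ≠ 0) : FiniteMultiplicity p q :=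
    FiniteMultiplicity.of_not_isUnit hp.not_isUnit hq
  have h1 := Finset.emultiplicity_prod hp.prime s f
  rw [(h _ (Finset.prod_ne_zero_iff.2 hf)).emultiplicity_eq_multiplicity,
    Finset.sum_congr rfl fun i hi => (h _ (hf i hi)).emultiplicity_eq_multiplicity] at h1
  exact_mod_cast h1

/-- A root of p in the algebraic closure is an eigenvalue of y, hence a root of Q, and p is its
minimal polynomial up to a unit. -/
theorem irreducible_dvd_of_dvd_charpoly {m : Type*} [Fintype m] [DecidableEq m] {y : Matrix m m K}
    {p Q : K[X]} (hp : Irreducible p) (hpy : p ∣ y.charpoly) (hQ : aeval y Q = 0) : p ∣ Q := by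
  let E := AlgebraicClosure K
  obtain ⟨r, hr⟩ := IsAlgClosed.exists_aeval_eq_zero E p (degree_pos_of_irreducible hp).ne'
  have hr' : r ∈ (y.map (algebraMap K E)).charpoly.roots := by
    rw [Matrix.charpoly_map, ← aroots_def, mem_aroots]
    exact ⟨y.charpoly_monic.ne_zero, aeval_eq_zero_of_dvd_aeval_eq_zero hpy hr⟩
  have hQ' : aeval (y.map (algebraMap K E)) (Q.map (algebraMap K E)) = 0 := by
    rw [aeval_map_algebraMap]
    have := aeval_algHom_apply ((Algebra.ofId K E).mapMatrix (m := m)) y Q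
    rw [hQ, map_zero] at this
    exact this
  have h := eval_eq_zero_of_isRoot_charpoly _ hQ' hr'
  rw [eval_map_algebraMap] at h
  have h6 := minpoly.dvd K r h
  rw [← minpoly.eq_of_irreducible hp hr] at h6
  exact dvd_of_mul_right_dvd h6

/-- A nonscalar matrix annihilated by a separable polynomial has more than one eigenvalue. -/
theorem multiplicity_charpoly_lt {m : Type*} [Fintype m] [DecidableEq m]
    {y : Matrix m m K} (hy : ¬ ∃ c, y = Matrix.scalar m c) {p Q : K[X]} (hp : Irreducible p)
    (hpy : p ∣ y.charpoly) (hQs : Q.Separable) (hQ : aeval y Q = 0) :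
    multiplicity p y.charpoly < Fintype.card m := by
  by_contra! hle
  have hdeg := y.charpoly_natDegree_eq_dim
  have h1 : p ^ Fintype.card m ∣ y.charpoly := pow_dvd_of_le_multiplicity hle
  have hn : 0 < Fintype.card m := by
    rw [← hdeg]
    exact hp.natDegree_pos.trans_le (natDegree_le_of_dvd hpy y.charpoly_monic.ne_zero)
  have h2 := natDegree_le_of_dvd h1 y.charpoly_monic.ne_zero
  -- By degrees p is linear and the characteristic polynomial is (X - c)^n; the minimal polynomial
  -- divides the squarefree Q, so it divides X - c and y is scalar.
  rw [natDegree_pow, hdeg] at h2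
  have h3 : p.natDegree = 1 :=
    le_antisymm (Nat.le_of_mul_le_mul_left (by rwa [mul_one]) hn) hp.natDegree_pos
  obtain ⟨c, hc⟩ := exists_root_of_degree_eq_one (degree_eq_iff_natDegree_eq_of_pos one_pos |>.2 h3)
  have h4 : (X - C c) ^ Fintype.card m ∣ y.charpoly :=
    (pow_dvd_pow_of_dvd (dvd_iff_isRoot.2 hc) _).trans h1
  have h5 : y.charpoly = (X - C c) ^ Fintype.card m := by
    refine (eq_of_dvd_of_natDegree_le_of_leadingCoeff h4 ?_ ?_).symm
    · rw [hdeg, natDegree_pow, natDegree_X_sub_C, mul_one]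
    · rw [((monic_X_sub_C c).pow _).leadingCoeff, y.charpoly_monic.leadingCoeff]
  have h6 : minpoly K y ∣ (X - C c) ^ Fintype.card m := by
    rw [← h5]
    exact minpoly.dvd _ _ y.aeval_self_charpoly
  obtain ⟨i, -, hi⟩ := (dvd_prime_pow (prime_X_sub_C c) _).1 h6
  have hi1 : i ≤ 1 := by
    by_contra! h
    have h7 : (X - C c) * (X - C c) ∣ Q := by
      rw [← pow_two]
      exact ((pow_dvd_pow _ h).trans hi.symm.dvd).trans (minpoly.dvd _ _ hQ)
    exact (prime_X_sub_C c).not_isUnit (hQs.squarefree _ h7)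
  have h8 : minpoly K y ∣ X - C c := by
    have := hi.dvd.trans (pow_dvd_pow (X - C c) hi1)
    rwa [pow_one] at this
  refine hy ⟨c, ?_⟩
  obtain ⟨w, hw⟩ := h8
  have h9 := congrArg (aeval y) hw
  rw [map_mul, minpoly.aeval, zero_mul, map_sub, aeval_X, aeval_C, sub_eq_zero] at h9
  rw [h9]
  rfl

end Multiplicity

/-! ### Diagonal blocks of block diagonal matrices -/

section Blocks

open Polynomial

variable {K ι : Type*} [Field K] {n : ℕ} {p : Fin n → ι} {Y : Matrix (Fin n) (Fin n) K}

/-- Block diagonality of the right factor suffices, so the induction for polynomials in Y never has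
to track that of powers of Y. -/
theorem toSquareBlock_mul_of_blockDiag [DecidableEq ι] (A : Matrix (Fin n) (Fin n) K)
    (hY : ∀ a b, p a ≠ p b → Y a b = 0) (c : ι) :
    (A * Y).toSquareBlock p c = A.toSquareBlock p c * Y.toSquareBlock p c := by
  ext a b
  simp only [Matrix.toSquareBlock_def, Matrix.mul_apply, Matrix.of_apply]
  rw [← Finset.sum_subtype (Finset.univ.filter fun x => p x = c) (by simp)
    (fun x => A a x * Y x b)]
  refine (Finset.sum_filter_of_ne fun x _ hx => ?_).symm
  by_contra hne
  exact hx (by rw [hY x b fun h => hne (h.trans b.2), mul_zero])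

theorem toSquareBlock_aeval [DecidableEq ι] (hY : ∀ a b, p a ≠ p b → Y a b = 0) (b : K[X]) (c : ι) :
    (aeval Y b).toSquareBlock p c = aeval (Y.toSquareBlock p c) b := by
  induction b using Polynomial.induction_on with
  | C r =>
    ext a b
    simp [Matrix.toSquareBlock_def, Matrix.algebraMap_matrix_apply, Subtype.ext_iff]
  | add f g hf hg =>
    rw [map_add, map_add, ← hf, ← hg]
    rfl
  | monomial k r h =>
    rw [pow_succ, ← mul_assoc, map_mul _ (C r * X ^ k), map_mul _ (C r * X ^ k), ← h, aeval_X,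
      aeval_X, toSquareBlock_mul_of_blockDiag _ hY]

theorem charpoly_eq_prod_toSquareBlock [Fintype ι] [LinearOrder ι]
    (hY : ∀ a b, p a ≠ p b → Y a b = 0) :
    Y.charpoly = ∏ c, (Y.toSquareBlock p c).charpoly := by
  have h : Y.BlockTriangular p := fun a b hab => hY a b hab.ne'
  simp only [Matrix.charpoly, h.charmatrix.det_fintype, Matrix.charmatrix_toSquareBlock]

end Blocks

/-! ### Frobenius stable Levi subgroups and matrices over the finite field -/

theorem coe_glIncl {K E : Type*} [Field K] [Field E] [Algebra K E] {n : ℕ} (z : GL (Fin n) K) :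
    (glIncl K E n z : Matrix (Fin n) (Fin n) E) =
      (z : Matrix (Fin n) (Fin n) K).map (algebraMap K E) := rfl

/-- Conjugation by a unit, as an algebra endomorphism. -/
def unitsConj (R : Type*) {A : Type*} [CommRing R] [Ring A] [Algebra R A] (u : Aˣ) : A →ₐ[R] A :=
  MulSemiringAction.toAlgHom R A (ConjAct.toConjAct u)

theorem unitsConj_apply {R A : Type*} [CommRing R] [Ring A] [Algebra R A] (u : Aˣ) (a : A) :
    unitsConj R u a = u * a * (u⁻¹ : Aˣ) := rfl

section Frobenius

variable {K E : Type*} [Field K] [Field E] [Algebra K E] {n : ℕ}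
  {M : Subgroup (GL (Fin n) E)} {W : Matrix (Fin n) (Fin n) E}

/-- Every element of M is the Frobenius image of an element of M, so Frobenius preserves the
commutant of M. Hence Galois traces stay in it. -/
theorem commute_map_pow [Fintype K] (hM : IsFrobStable K M)
    (hW : ∀ g ∈ M, Commute W (g : Matrix (Fin n) (Fin n) E)) (j : ℕ) :
    ∀ g ∈ M, Commute (W.map fun x => x ^ Fintype.card K ^ j) (g : Matrix (Fin n) (Fin n) E) := by
  induction j with
  | zero =>
    intro g hg
    have : (W.map fun x => x ^ Fintype.card K ^ 0) = W := by ext; simp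
    rw [this]
    exact hW g hg
  | succ j ih =>
    intro g hg
    rw [← hM] at hg
    obtain ⟨g, hg, rfl⟩ := hg
    have h := (ih g hg).map (FiniteField.frobeniusAlgHom K E : E →+* E).mapMatrix
    have h1 : (W.map fun x => x ^ Fintype.card K ^ (j + 1)) =
        (FiniteField.frobeniusAlgHom K E : E →+* E).mapMatrix
          (W.map fun x => x ^ Fintype.card K ^ j) := by
      ext a b
      simp [pow_succ, pow_mul]
    rw [h1]
    exact h

theorem exists_generalLinear_eq_sub [Infinite E] (W : Matrix (Fin n) (Fin n) E) :
    ∃ (c : E) (z : GL (Fin n) E),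
      (z : Matrix (Fin n) (Fin n) E) = Matrix.scalar (Fin n) c - W := by
  classical
  obtain ⟨c, hc⟩ := Infinite.exists_notMem_finset W.charpoly.roots.toFinset
  refine ⟨c, Matrix.GeneralLinearGroup.mkOfDetNeZero (Matrix.scalar (Fin n) c - W) ?_, rfl⟩
  rw [← Matrix.eval_charpoly]
  intro h
  exact hc (Multiset.mem_toFinset.2 ((Polynomial.mem_roots W.charpoly_monic.ne_zero).2 h))

/-- If `Z_M ≤ g L g⁻¹` then matrices over `K` in the linear span of `Z_M` are block diagonal after
conjugation by `g`. -/
theorem conj_apply_eq_zero [Infinite E] (hM : IsLevi M) {ι : Type*} [DecidableEq ι]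
    {p : Fin n → ι} {g : GL (Fin n) K}
    (h : centre M ≤ (blockDiag E p).map (MulAut.conj (glIncl K E n g)).toMonoidHom)
    {y : Matrix (Fin n) (Fin n) K}
    (hy : ∀ g ∈ M, Commute (y.map (algebraMap K E)) (g : Matrix (Fin n) (Fin n) E)) (a b : Fin n)
    (hab : p a ≠ p b) : ((g⁻¹ : GL (Fin n) K) * y * g : Matrix (Fin n) (Fin n) K) a b = 0 := by
  -- y need not be invertible, but c - y is for c outside the spectrum; the scalar c does not affect
  -- off-diagonal entries.
  obtain ⟨c, z, hz⟩ := exists_generalLinear_eq_sub (y.map (algebraMap K E))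
  have hzM : z ∈ centre M := hM.mem_centre_iff.2 fun g hg => by
    have : Commute (z : Matrix (Fin n) (Fin n) E) g := by
      rw [hz]
      exact (Matrix.scalar_commute c (Commute.all c) _).sub_left (hy g hg)
    exact Units.ext this
  obtain ⟨u, hu, huz⟩ := h hzM
  have h1 : u = glIncl K E n g⁻¹ * z * glIncl K E n g := by
    rw [← huz]
    simp [mul_assoc]
  have h2 := hu a b hab
  have hne : a ≠ b := fun h => hab (h ▸ rfl)
  rw [h1, Units.val_mul, Units.val_mul, hz, mul_sub, sub_mul, Matrix.sub_apply,
    ← (Matrix.scalar_commute c (Commute.all c) _).eq, mul_assoc, ← Units.val_mul, ← map_mul,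
    inv_mul_cancel, map_one, Units.val_one, mul_one, Matrix.scalar_apply,
    Matrix.diagonal_apply_ne _ hne, zero_sub, neg_eq_zero, coe_glIncl, coe_glIncl,
    ← RingHom.mapMatrix_apply, ← RingHom.mapMatrix_apply, ← RingHom.mapMatrix_apply, ← map_mul,
    ← map_mul, RingHom.mapMatrix_apply, Matrix.map_apply] at h2
  exact (map_eq_zero _).1 h2

/-- A proper Frobenius stable Levi subgroup commutes with a nonscalar semisimple matrix over the
finite field. -/
theorem IsLevi.exists_nonscalar_commute [Fintype K] [Infinite E] [Algebra.IsAlgebraic K E]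
    (hM : IsLevi M) (hF : IsFrobStable K M) (hne : M ≠ ⊤) :
    ∃ (y : Matrix (Fin n) (Fin n) K) (Q : Polynomial K), (¬ ∃ c, y = Matrix.scalar (Fin n) c) ∧
      (∀ g ∈ M, Commute (y.map (algebraMap K E)) (g : Matrix (Fin n) (Fin n) E)) ∧
      Q.Separable ∧ Polynomial.aeval y Q = 0 := by
  obtain ⟨p, x, rfl⟩ := hM
  obtain ⟨a, b, hab⟩ : ∃ a b, p a ≠ p b := by
    by_contra! h
    apply hne
    have : blockDiag E p = ⊤ := eq_top_iff.2 fun g _ a b hab => absurd (h a b) hab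
    rw [this]
    exact Subgroup.map_top_of_surjective _ (MulAut.conj x).surjective
  -- P is the projection to one summand of the decomposition of E^n stabilized by M; it commutes
  -- with M but need not be defined over K.
  set e : Matrix (Fin n) (Fin n) E := labelIdempotent p (p a) with he
  set P : Matrix (Fin n) (Fin n) E := x * e * (x⁻¹ : GL (Fin n) E) with hPdef
  have hP : ¬ ∃ c, P = Matrix.scalar (Fin n) c := by
    rintro ⟨c, hc⟩
    have h1 : e = (x⁻¹ : GL (Fin n) E) * P * x := by
      simp [hPdef, mul_assoc]
    rw [hc, ← (Matrix.scalar_commute c (Commute.all c) _).eq, mul_assoc, ← Units.val_mul,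
      inv_mul_cancel, Units.val_one, mul_one] at h1
    have h2 := congrFun (congrFun h1 a) a
    have h3 := congrFun (congrFun h1 b) b
    simp [he, labelIdempotent] at h2
    simp [he, labelIdempotent, hab.symm] at h3
    exact one_ne_zero (h2.trans h3.symm)
  obtain ⟨y, t, d, hy, hyP⟩ := exists_nonscalar_descent (K := K) P hP
  have hcomm : ∀ g ∈ (blockDiag E p).map (MulAut.conj x).toMonoidHom,
      Commute (y.map (algebraMap K E)) (g : Matrix (Fin n) (Fin n) E) := by
    intro g hg
    rw [hyP]
    refine Commute.sum_left _ _ _ fun j _ => commute_map_pow hF (fun g hg => ?_) j g hg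
    refine Commute.smul_left ?_ t
    obtain ⟨g, hg, rfl⟩ := hg
    have h1 : Commute (g : Matrix (Fin n) (Fin n) E) e :=
      (blockDiag_iff_commute p _).1 hg (p a)
    have h2 : (((MulAut.conj x).toMonoidHom g : GL (Fin n) E) : Matrix (Fin n) (Fin n) E) =
        x * g * (x⁻¹ : GL (Fin n) E) := by simp
    rw [h2, hPdef]
    exact h1.symm.map (unitsConj E x)
  set w : Matrix (Fin n) (Fin n) E := (x⁻¹ : GL (Fin n) E) * y.map (algebraMap K E) * x with hw
  have hwB : ∀ g ∈ blockDiag E p, Commute w (g : Matrix (Fin n) (Fin n) E) := by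
    intro g hg
    have h1 := (hcomm _ ⟨g, hg, rfl⟩).map (unitsConj E x⁻¹)
    rw [unitsConj_apply, unitsConj_apply] at h1
    simpa [hw, mul_assoc] using h1
  -- w is diagonal, so a polynomial over K killing its diagonal entries kills w, and hence its
  -- conjugate y.
  obtain ⟨Q, hQ, hQw⟩ := exists_separable_annihilator (K := K) fun a => w a a
  refine ⟨y, Q, hy, hcomm, hQ, ?_⟩
  have hQw' : Polynomial.aeval w Q = 0 := by
    rw [eq_diagonal_of_commute_blockDiag hwB]
    have h1 := Polynomial.aeval_algHom_apply
      (Matrix.diagonalAlgHom (n := Fin n) (α := E) K) (fun a => w a a) Q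
    have h2 : Polynomial.aeval (fun a => w a a) Q = 0 := by
      funext a
      rw [Pi.zero_apply, ← hQw a]
      exact (Polynomial.aeval_algHom_apply (Pi.evalAlgHom K (fun _ : Fin n => E) a) _ Q).symm
    rw [h2, map_zero] at h1
    exact h1
  have hyw : y.map (algebraMap K E) = unitsConj K x w := by
    rw [unitsConj_apply, hw]
    simp [mul_assoc]
  have h1 := Polynomial.aeval_algHom_apply ((Algebra.ofId K E).mapMatrix (m := Fin n)) y Q
  have h2 : (Algebra.ofId K E).mapMatrix y = unitsConj K x w := hyw
  rw [h2, Polynomial.aeval_algHom_apply, hQw', map_zero] at h1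
  exact Matrix.map_injective (algebraMap K E).injective
    (h1.symm.trans (map_zero ((Algebra.ofId K E).mapMatrix (m := Fin n))).symm)

end Frobenius

theorem exists_diagGL_of_commute {K E ι : Type*} [Field K] [Field E] [Infinite E] [Algebra K E]
    [DecidableEq ι] {n : ℕ} {p : Fin n → ι} {z : GL (Fin n) K}
    (hz : ∀ g ∈ blockDiag E p, Commute (glIncl K E n z) g) :
    ∃ f : Fin n → Kˣ, z = diagGL f ∧ ∀ a b, p a = p b → f a = f b := by
  have hz' : ∀ g ∈ blockDiag E p, Commute (glIncl K E n z : Matrix (Fin n) (Fin n) E)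
      (g : Matrix (Fin n) (Fin n) E) := fun g hg => (hz g hg).map (Units.coeHom _)
  have hd : (z : Matrix (Fin n) (Fin n) K) = Matrix.diagonal fun a => z a a := by
    ext a b
    by_cases hab : a = b
    · simp [hab]
    · have := eq_zero_of_commute_blockDiag hz' hab
      rw [coe_glIncl, Matrix.map_apply, map_eq_zero] at this
      rw [this, Matrix.diagonal_apply_ne _ hab]
  have hu : IsUnit fun a => z a a := Matrix.isUnit_diagonal.1 (hd ▸ z.isUnit)
  have hu' := Pi.isUnit_iff.1 hu
  refine ⟨fun a => (hu' a).unit, Units.ext ?_, fun a b hab => Units.ext ?_⟩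
  · rw [coe_diagGL]
    exact hd
  · have := diag_eq_of_commute_blockDiag hz' hab
    rw [coe_glIncl, Matrix.map_apply, Matrix.map_apply] at this
    exact (algebraMap K E).injective this

/-! ### The first implication -/

theorem coe_conjToLevi {K E : Type*} [Field K] [Field E] [Algebra K E] {n : ℕ} (X : HCDatum K n)
    (M : Subgroup (GL (Fin n) E)) (g : GL (Fin n) K)
    (h : centre M ≤ (X.levi E).map (MulAut.conj (glIncl K E n g)).toMonoidHom)
    (z : ratPts K (centre M)) :
    (conjToLevi X M g h z : GL (Fin n) K) = g⁻¹ * z * g := by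
  simp [conjToLevi]

theorem gammaChar_apply {K E : Type*} [Field K] [Field E] [Algebra K E] {n k : ℕ}
    (X : Fin k → HCDatum K n) (M : Subgroup (GL (Fin n) E)) (g : Fin k → GL (Fin n) K)
    (h : ∀ i, centre M ≤ ((X i).levi E).map (MulAut.conj (glIncl K E n (g i))).toMonoidHom)
    (z : ratPts K (centre M)) :
    gammaChar X M g h z = ∏ i, (X i).leviChar (conjToLevi (X i) M (g i) (h i) z) := by
  rw [gammaChar, MonoidHom.finsetProd_apply]
  rfl

section

variable {K E : Type*} [Field K] [Field E] [Algebra K E] {n k : ℕ}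
  {X : Fin k → HCDatum K n} {M : Subgroup (GL (Fin n) E)} {g : Fin k → GL (Fin n) K}

theorem gammaChar_eq_one_of_mem_centre_top [Infinite E]
    (h : ∀ i, centre M ≤ ((X i).levi E).map (MulAut.conj (glIncl K E n (g i))).toMonoidHom)
    (hσ : ∏ v, tupleSigma X v ^ tupleDim X v = 1) (z : ratPts K (centre M))
    (hz : (z : GL (Fin n) K) ∈ ratPts K (centre (⊤ : Subgroup (GL (Fin n) E)))) :
    gammaChar X M g h z = 1 := by
  obtain ⟨f, hf, hconst⟩ := exists_diagGL_of_commute (p := fun _ : Fin n => ())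
    fun x (_ : x ∈ blockDiag E _) => (mem_centre.1 hz).2 x trivial
  obtain ⟨c, hc⟩ : ∃ c, f = fun _ => c := by
    rcases isEmpty_or_nonempty (Fin n) with hn | ⟨⟨a⟩⟩
    · exact ⟨1, Subsingleton.elim _ _⟩
    · exact ⟨f a, funext fun b => hconst b a rfl⟩
  subst hc
  have hconj (i) : (conjToLevi (X i) M (g i) (h i) z : GL (Fin n) K) = diagGL fun _ => c := by
    have h1 : Commute (diagGL fun _ : Fin n => c) (g i) :=
      Units.ext (Matrix.scalar_commute (c : K) (Commute.all _) _)
    rw [coe_conjToLevi, hf, mul_assoc, h1.eq, inv_mul_cancel_left]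
  rw [gammaChar_apply]
  simp_rw [fun i => (X i).leviChar_of_eq_diagGL (hconj i), Finset.prod_const, Finset.card_univ,
    HCDatum.card_label]
  rw [hasDifferences_tupleDim.prod_tupleSigma] at hσ
  have h2 := DFunLike.congr_fun hσ c
  simpa [MonoidHom.finsetProd_apply] using h2

theorem exists_gammaChar_ne_one [Fintype K] [Infinite E] [Algebra.IsAlgebraic K E]
    (hH : tupleH X = {tupleDim X}) (hM : IsLevi M)
    (h : ∀ i, centre M ≤ ((X i).levi E).map (MulAut.conj (glIncl K E n (g i))).toMonoidHom)
    {M' : Subgroup (GL (Fin n) E)} (hM' : IsLevi M') (hF : IsFrobStable K M') (hMM' : M ≤ M')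
    (htop : M' ≠ ⊤) :
    ∃ z : ratPts K (centre M), (z : GL (Fin n) K) ∈ ratPts K (centre M') ∧
      gammaChar X M g h z ≠ 1 := by
  obtain ⟨y, Q, hy, hcomm, hQs, hQ⟩ := hM'.exists_nonscalar_commute hF htop
  have hcard : 0 < Fintype.card (Fin n) := by
    by_contra! h0
    have := Fintype.card_eq_zero_iff.1 (Nat.le_zero.1 h0)
    exact hy ⟨0, Subsingleton.elim _ _⟩
  obtain ⟨p, hp, hpy⟩ : ∃ p, Irreducible p ∧ p ∣ y.charpoly :=
    Polynomial.exists_irreducible_of_natDegree_ne_zero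
      (by rw [y.charpoly_natDegree_eq_dim]; exact hcard.ne')
  have hpQ := irreducible_dvd_of_dvd_charpoly hp hpy hQ
  have hlt := multiplicity_charpoly_lt hy hp hpy hQs hQ
  rw [Fintype.card_fin] at hlt
  set d := multiplicity p y.charpoly with hd
  have hdpos : 0 < d := by
    rw [hd, Nat.pos_iff_ne_zero, Ne, multiplicity_eq_zero]
    exact not_not.2 hpy
  let Y (i : Fin k) : Matrix (Fin n) (Fin n) K := ((g i)⁻¹ : GL (Fin n) K) * y * g i
  have hYconj (i) : Y i = unitsConj K (g i)⁻¹ y := by simp [Y, unitsConj_apply]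
  have hYcharpoly (i) : (Y i).charpoly = y.charpoly := by
    simp only [Y, Matrix.coe_units_inv]
    exact Matrix.charpoly_units_conj' (g i) y
  have hY (i) : ∀ a b, (X i).label a ≠ (X i).label b → Y i a b = 0 :=
    conj_apply_eq_zero hM (h i) fun x hx => hcomm x (hMM' hx)
  let B (i) (l : Fin ((X i).s + 1)) := (Y i).toSquareBlock (X i).label l
  let m (i) (l : Fin ((X i).s + 1)) : ℕ := multiplicity p (B i l).charpoly
  have hsum (i) : d = ∑ l, m i l := by
    rw [hd, ← multiplicity_prod hp _ _ fun l _ => (B i l).charpoly_monic.ne_zero,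
      ← charpoly_eq_prod_toSquareBlock (hY i), hYcharpoly]
  have hBQ (i l) : Polynomial.aeval (B i l) Q = 0 := by
    rw [← toSquareBlock_aeval (hY i), hYconj, Polynomial.aeval_algHom_apply, hQ, map_zero]
    exact Matrix.ext fun a b => rfl
  by_contra! hall
  have hγ : ∏ i, ∏ l, (X i).γ l ^ m i l = 1 := by
    ext1 c
    -- The same b serves y and every block `B i l`, since Q annihilates them all.
    obtain ⟨b, hb⟩ := exists_det_aeval_eq_pow_multiplicity hp hQs hpQ (c : K)
    let z : GL (Fin n) K := Matrix.GeneralLinearGroup.mkOfDetNeZero (Polynomial.aeval y b)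
      (by rw [hb y hQ]; exact pow_ne_zero _ c.ne_zero)
    have hzM' : z ∈ ratPts K (centre M') := by
      refine hM'.mem_centre_iff.2 fun x hx => Units.ext ?_
      have h1 : (glIncl K E n z : Matrix (Fin n) (Fin n) E) =
          Polynomial.aeval (y.map (algebraMap K E)) b :=
        (Polynomial.aeval_algHom_apply ((Algebra.ofId K E).mapMatrix (m := Fin n)) y b).symm
      rw [Units.val_mul, Units.val_mul, h1]
      have h2 : Polynomial.aeval (y.map (algebraMap K E)) b ∈
          Subalgebra.centralizer K {(x : Matrix (Fin n) (Fin n) E)} := by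
        refine Algebra.adjoin_le (Set.singleton_subset_iff.2 ?_)
          (Polynomial.aeval_mem_adjoin_singleton K _)
        rintro _ rfl
        exact (hcomm x hx).eq.symm
      exact ((Subalgebra.mem_centralizer_iff K).1 h2 _ rfl).symm
    have h1 := hall ⟨z, hM.centre_le_centre hMM' hzM'⟩ hzM'
    rw [gammaChar_apply] at h1
    rw [MonoidHom.one_apply, ← h1, MonoidHom.finsetProd_apply]
    refine Finset.prod_congr rfl fun i _ => ?_
    rw [HCDatum.leviChar_apply, MonoidHom.finsetProd_apply]
    refine Finset.prod_congr rfl fun l _ => ?_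
    rw [MonoidHom.pow_apply, ← map_pow]
    refine congrArg _ (Units.ext ?_)
    rw [Units.val_pow_eq_pow_val, ← hb _ (hBQ i l), Matrix.GeneralLinearGroup.val_det_apply,
      HCDatum.coe_blockProj, coe_conjToLevi, ← toSquareBlock_aeval (hY i), hYconj,
      Polynomial.aeval_algHom_apply, unitsConj_apply, inv_inv]
    rfl
  -- The block multiplicities of p define an element of H* with central entry d < n, so different
  -- from α.
  obtain ⟨δ, hδ0, hδ⟩ := exists_hasDifferences (X := X) m d hsum
  have hmem : δ ∈ tupleH X := by
    refine ⟨hδ.nonincreasing, ?_, hδ.le hasDifferences_tupleDim (fun i l => ?_) ?_, ?_⟩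
    · refine lt_of_le_of_ne (fun v => Nat.zero_le _) fun h0 => ?_
      rw [← h0] at hδ0
      exact hdpos.ne hδ0
    · refine (multiplicity_le_natDegree hp (B i l).charpoly_monic.ne_zero).trans ?_
      rw [(B i l).charpoly_natDegree_eq_dim, HCDatum.card_label]
    · rw [hδ0]
      exact hlt.le
    · rw [hδ.prod_tupleSigma, hγ]
  rw [hH, Set.mem_singleton_iff] at hmem
  rw [hmem] at hδ0
  exact hlt.ne hδ0.symm

theorem isGenericTuple_of_tupleH_eq [Fintype K] [Infinite E] [Algebra.IsAlgebraic K E]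
    (hH : tupleH X = {tupleDim X}) : IsGenericTuple E X := by
  have hα : tupleDim X ∈ tupleH X := by rw [hH]; rfl
  exact fun M hM _ g h => ⟨gammaChar_eq_one_of_mem_centre_top h hα.2.2.2,
    fun M' hM' hF hMM' htop => exists_gammaChar_ne_one hH hM h hM' hF hMM' htop⟩

end

/-! ### Permutation matrices and the second implication -/

/-- Permutation matrices as elements of the general linear group. -/
def permGL (K : Type*) [Field K] {n : ℕ} (w : Equiv.Perm (Fin n)) : GL (Fin n) K :=
  Matrix.GeneralLinearGroup.mkOfDetNeZero (Equiv.Perm.permMatrix K w.symm) (by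
    rw [Matrix.det_permutation]
    exact ((Units.isUnit (Equiv.Perm.sign w.symm)).map (Int.castRingHom K)).ne_zero)

theorem permGL_apply {K : Type*} [Field K] {n : ℕ} (w : Equiv.Perm (Fin n)) (a b : Fin n) :
    (permGL K w : Matrix (Fin n) (Fin n) K) a b = if a = w b then 1 else 0 := by
  have : (permGL K w : Matrix (Fin n) (Fin n) K) = Equiv.Perm.permMatrix K w.symm := rfl
  simp [this, Equiv.Perm.permMatrix, PEquiv.toMatrix_apply, Equiv.toPEquiv_apply,
    Equiv.symm_apply_eq]

theorem glIncl_permGL_apply {K E : Type*} [Field K] [Field E] [Algebra K E] {n : ℕ}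
    (w : Equiv.Perm (Fin n)) (a b : Fin n) :
    (glIncl K E n (permGL K w) : Matrix (Fin n) (Fin n) E) a b = if a = w b then 1 else 0 := by
  rw [coe_glIncl, Matrix.map_apply, permGL_apply]
  split_ifs <;> simp

/-- Phrased through the entries of g so as to apply both to `permGL` over K and to its image over E.
-/
theorem conj_diagonal_of_perm {R : Type*} [CommRing R] {n : ℕ} (w : Equiv.Perm (Fin n))
    {g : GL (Fin n) R} (hg : ∀ a b, (g : Matrix (Fin n) (Fin n) R) a b = if a = w b then 1 else 0)
    (f : Fin n → R) :
    ((g⁻¹ : GL (Fin n) R) : Matrix (Fin n) (Fin n) R) * Matrix.diagonal f * g =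
      Matrix.diagonal (f ∘ w) := by
  have h : Matrix.diagonal f * g = (g : Matrix (Fin n) (Fin n) R) * Matrix.diagonal (f ∘ w) := by
    ext a b
    rw [Matrix.diagonal_mul, Matrix.mul_diagonal, hg]
    by_cases hab : a = w b
    · simp [hab]
    · simp [hab]
  rw [mul_assoc, h, ← mul_assoc, ← Units.val_mul, inv_mul_cancel, Units.val_one, one_mul]

theorem isFrobStable_blockDiag {K E ι : Type*} [Field K] [Fintype K] [Field E] [Algebra K E]
    [Algebra.IsAlgebraic K E] [DecidableEq ι] {n : ℕ} (p : Fin n → ι) :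
    IsFrobStable K (blockDiag E p) := by
  have hF (g : GL (Fin n) E) (a b : Fin n) : (glFrob K E n g : Matrix (Fin n) (Fin n) E) a b =
      FiniteField.frobeniusAlgHom K E (g a b) := rfl
  let φ := FiniteField.frobeniusAlgEquivOfAlgebraic K E
  refine le_antisymm ?_ fun g hg => ?_
  · rintro _ ⟨g, hg, rfl⟩ a b hab
    rw [hF, hg a b hab, map_zero]
  · refine ⟨Matrix.GeneralLinearGroup.map (φ.symm : E →+* E) g, fun a b hab => ?_,
      Units.ext (Matrix.ext fun a b => ?_)⟩
    · have : (Matrix.GeneralLinearGroup.map (φ.symm : E →+* E) g : Matrix (Fin n) (Fin n) E) a b =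
        φ.symm (g a b) := rfl
      rw [this, hg a b hab, map_zero]
    · exact φ.apply_symm_apply (g a b)

theorem isLevi_blockDiag {E : Type*} [Field E] {n : ℕ} (p : Fin n → Fin n) :
    IsLevi (blockDiag E p) := by
  refine ⟨p, 1, ?_⟩
  rw [map_one]
  exact (Subgroup.map_id _).symm

theorem blockDiag_ne_top {E ι : Type*} [Field E] [DecidableEq ι] {n : ℕ} {p : Fin n → ι}
    {a b : Fin n} (hab : p a ≠ p b) : blockDiag E p ≠ ⊤ := by
  intro h
  have hne : a ≠ b := fun h => hab (h ▸ rfl)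
  have h1 : elemGL E a b hne ∈ blockDiag E p := h ▸ Subgroup.mem_top _
  have h2 := h1 a b hab
  rw [coe_elemGL, Matrix.add_apply, Matrix.one_apply_ne hne, Matrix.single_apply_same,
    zero_add] at h2
  exact one_ne_zero h2

/-- The centre is diagonal, permutations keep it diagonal, and diagonal matrices lie in every block
diagonal group. -/
theorem centre_blockDiag_le_conj {K E ι κ : Type*} [Field K] [Field E] [Infinite E] [Algebra K E]
    [DecidableEq ι] [DecidableEq κ] {n : ℕ} (p : Fin n → ι) (q : Fin n → κ)
    (w : Equiv.Perm (Fin n)) :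
    centre (blockDiag E p) ≤
      (blockDiag E q).map (MulAut.conj (glIncl K E n (permGL K w))).toMonoidHom := by
  intro z hz
  set u := glIncl K E n (permGL K w)
  refine ⟨u⁻¹ * z * u, fun a b hab => ?_, by simp [mul_assoc]⟩
  have h1 := eq_diagonal_of_commute_blockDiag (p := p) (w := (z : Matrix (Fin n) (Fin n) E))
    fun g hg => ((mem_centre.1 hz).2 g hg).map (Units.coeHom _)
  rw [Units.val_mul, Units.val_mul, h1, conj_diagonal_of_perm w (glIncl_permGL_apply w)]
  exact Matrix.diagonal_apply_ne _ fun h => hab (h ▸ rfl)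

/-- A permutation distributing the first `d` coordinates over the fibres of `q` with prescribed
multiplicities. -/
theorem exists_perm_prod_fibers {n d : ℕ} {ι A : Type*} [Fintype ι] [DecidableEq ι] [CommMonoid A]
    (q : Fin n → ι) (m m' : ι → ℕ) (hm : ∀ l, m l + m' l = Fintype.card {a // q a = l})
    (hd : d = ∑ l, m l) :
    ∃ w : Equiv.Perm (Fin n), ∀ (l : ι) (x y : A),
      ∏ a : {a // q a = l}, (if (w a : ℕ) < d then x else y) = x ^ m l * y ^ m' l := by
  classical
  have hcard (l : ι) : (Finset.univ.filter fun a => q a = l).card = m l + m' l := by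
    rw [hm, Fintype.card_subtype]
  have hT (l : ι) : ∃ T ⊆ Finset.univ.filter fun a => q a = l, T.card = m l :=
    Finset.exists_subset_card_eq (by rw [hcard]; exact Nat.le_add_right _ _)
  -- w will carry the union of the chosen sets `T l` onto the first d coordinates.
  choose T hTsub hTcard using hT
  have hTl (l : ι) : T l = Finset.univ.filter fun a => a ∈ T (q a) ∧ q a = l := by
    ext a
    simp only [Finset.mem_filter, Finset.mem_univ, true_and]
    refine ⟨fun h => ?_, fun h => h.2 ▸ h.1⟩
    have h1 := (Finset.mem_filter.1 (hTsub l h)).2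
    exact ⟨h1.symm ▸ h, h1⟩
  have hS : Fintype.card {a // a ∈ T (q a)} = d := by
    rw [Fintype.card_subtype, hd, Finset.card_eq_sum_card_fiberwise (f := q) (t := Finset.univ)
      (fun _ _ => Finset.mem_coe.2 (Finset.mem_univ _))]
    refine Finset.sum_congr rfl fun l _ => ?_
    rw [Finset.filter_filter, ← hTl, hTcard]
  have hdn : d ≤ n := by
    rw [← hS]
    exact (Fintype.card_subtype_le _).trans_eq (Fintype.card_fin n)
  have hS' : Fintype.card {a : Fin n // (a : ℕ) < d} = d := by
    rw [Fintype.card_subtype]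
    simp [Fin.card_filter_val_lt, hdn]
  let e : {a // a ∈ T (q a)} ≃ {a : Fin n // (a : ℕ) < d} :=
    Fintype.equivOfCardEq (hS.trans hS'.symm)
  refine ⟨e.extendSubtype, fun l x y => ?_⟩
  have hw (a : Fin n) : ((e.extendSubtype a : Fin n) : ℕ) < d ↔ a ∈ T (q a) := by
    refine ⟨fun h => ?_, fun h => e.extendSubtype_mem a h⟩
    by_contra hn
    exact e.extendSubtype_not_mem a hn h
  rw [← Finset.prod_subtype (Finset.univ.filter fun a => q a = l) (by simp)
    fun a => if ((e.extendSubtype a : Fin n) : ℕ) < d then x else y]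
  simp_rw [hw]
  rw [Finset.prod_ite, Finset.prod_const, Finset.prod_const]
  have h1 : (Finset.univ.filter fun a => q a = l).filter (fun a => a ∈ T (q a)) = T l := by
    rw [hTl, Finset.filter_filter]
    exact Finset.filter_congr fun a _ => and_comm
  have h2 := Finset.card_filter_add_card_filter_not (s := Finset.univ.filter fun a => q a = l)
    (fun a => a ∈ T (q a))
  rw [h1, hTcard, hcard] at h2
  rw [h1, hTcard, Nat.add_left_cancel h2]

section

variable {K E : Type*} [Field K] [Field E] [Algebra K E] {n k : ℕ}
  {X : Fin k → HCDatum K n}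

theorem pos_none_of_mem_tupleH {δ : TupleVertex X → ℕ} (hδ : δ ∈ tupleH X) : 0 < δ none := by
  by_contra! h0
  refine hδ.2.1.ne' (funext fun v => ?_)
  rcases v with _ | ⟨i, j⟩
  · exact Nat.le_zero.1 h0
  · exact Nat.le_zero.1 ((hδ.1 i (Fin.zero_le j.succ)).trans h0)

theorem not_isGenericTuple_of_add_eq [Fintype K] [Infinite E] [Algebra.IsAlgebraic K E]
    {δ ε : TupleVertex X → ℕ} (hδ : δ ∈ tupleH X) (hε : ε ∈ tupleH X)
    (hadd : δ + ε = tupleDim X) : ¬ IsGenericTuple E X := by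
  intro hgen
  have hδ0 := pos_none_of_mem_tupleH hδ
  have hε0 := pos_none_of_mem_tupleH hε
  have hn : δ none + ε none = n := congrFun hadd none
  obtain ⟨m, hm⟩ : ∃ m, HasDifferences X δ m := ⟨_, hasDifferences_of_nonincreasing hδ.1⟩
  obtain ⟨m', hm'⟩ : ∃ m, HasDifferences X ε m := ⟨_, hasDifferences_of_nonincreasing hε.1⟩
  have hsize : (fun i l => m i l + m' i l) = fun i => (X i).size :=
    (hm.add hm').unique (hadd ▸ hasDifferences_tupleDim)
  let o : Fin n := ⟨0, by omega⟩
  let o' : Fin n := ⟨δ none, by omega⟩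
  -- Each of the two blocks is labelled by its first coordinate; both are nonempty because δ_0 and
  -- ε_0 are positive.
  let p : Fin n → Fin n := fun a => if (a : ℕ) < δ none then o else o'
  have hpo : p o = o := if_pos hδ0
  have hpo' : p o' = o' := if_neg (lt_irrefl _)
  have hoo' : p o ≠ p o' := by
    rw [hpo, hpo']
    exact fun h => hδ0.ne (Fin.ext_iff.1 h)
  have hw (i) := exists_perm_prod_fibers (A := Kˣ) (X i).label (m i) (m' i)
    (fun l => (congrFun (congrFun hsize i) l).trans ((X i).card_label l).symm) (hm.sum_eq i)
  choose w hw using hw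
  have hle (i) : centre (blockDiag E p) ≤
      ((X i).levi E).map (MulAut.conj (glIncl K E n (permGL K (w i)))).toMonoidHom :=
    centre_blockDiag_le_conj p (X i).label (w i)
  -- Genericity is tested with M' = M.
  obtain ⟨z, hz, hz1⟩ := (hgen (blockDiag E p) (isLevi_blockDiag p) (isFrobStable_blockDiag p)
    (fun i => permGL K (w i)) hle).2 _ (isLevi_blockDiag p)
    (isFrobStable_blockDiag p) le_rfl (blockDiag_ne_top hoo')
  apply hz1
  obtain ⟨f, hf, hfp⟩ := exists_diagGL_of_commute (p := p) (mem_centre.1 hz).2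
  have hff (a : Fin n) : f a = if (a : ℕ) < δ none then f o else f o' := by
    split_ifs with ha
    · exact hfp a o (by rw [hpo]; exact if_pos ha)
    · exact hfp a o' (by rw [hpo']; exact if_neg ha)
  have hconj (i) : (conjToLevi (X i) (blockDiag E p) (permGL K (w i))
      (hle i) z : GL (Fin n) K) = diagGL (f ∘ w i) := by
    rw [coe_conjToLevi, hf]
    exact Units.ext (conj_diagonal_of_perm (w i) (permGL_apply (w i)) _)
  rw [gammaChar_apply]
  have h1 (i) (l : Fin ((X i).s + 1)) : ∏ a : {a // (X i).label a = l}, (f ∘ w i) a =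
      f o ^ m i l * f o' ^ m' i l := by
    rw [← hw]
    exact Finset.prod_congr rfl fun a _ => hff _
  simp_rw [fun i => (X i).leviChar_of_eq_diagGL (hconj i), h1, map_mul, map_pow,
    Finset.prod_mul_distrib]
  have h2 := hδ.2.2.2
  have h3 := hε.2.2.2
  rw [hm.prod_tupleSigma] at h2
  rw [hm'.prod_tupleSigma] at h3
  have h4 := DFunLike.congr_fun h2 (f o)
  have h5 := DFunLike.congr_fun h3 (f o')
  simp only [MonoidHom.finsetProd_apply, MonoidHom.pow_apply, MonoidHom.one_apply] at h4 h5
  rw [h4, h5, one_mul]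

end

end

theorem lemma4 {K : Type*} [Field K] [Fintype K] (E : Type*) [Field E] [Algebra K E]
    [IsAlgClosure K E] (n k : ℕ) (X : Fin k → HCDatum K n) :
    (tupleH X = {tupleDim X} → IsGenericTuple E X) ∧
    (IsGenericTuple E X →
      ¬ ∃ δ ∈ tupleH X \ {tupleDim X}, ∃ ε ∈ tupleH X \ {tupleDim X}, δ + ε = tupleDim X) := by
  have : IsAlgClosed E := IsAlgClosure.isAlgClosed K
  have : Infinite E := inferInstance
  refine ⟨isGenericTuple_of_tupleH_eq, ?_⟩
  rintro hgen ⟨δ, hδ, ε, hε, hadd⟩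
  exact not_isGenericTuple_of_add_eq hδ.1 hε.1 hadd hgen
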